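/- Let $k$ be a number field and let $E$ be an elliptic curve over $k$ given by $y^2=f(x)$, where $f(x)=x^3+\alpha x^2+\beta x+\gamma=(x-a)(x-b)(x-c)$ with $\alpha,\beta,\gamma,a,b,c\in k$ and the discriminant $\delta$ of $f$ is nonzero. Let $K=k(E)=k(x,y)$ be the function field of $E$. Let $S$ be a finite set of places of $k$ containing all archimedean places and all nonarchimedean places $u$ such that $u(2)\neq 0$, or $u(\delta)\neq 0$, or at least one of $u(\alpha),u(\beta),u(\gamma)$ is negative. Let $v$ be a place of $k$ not in $S$, viewed as a normalized discrete valuation. Let $\tilde v$ be the valuation of the subfield $k(y)\subset K$ given by $\tilde v(p)=\min_{a_i\neq 0}v(a_i)$ for nonzero $p=a_ny^n+\dots+a_0\in k[y]$, and let $w=w(v)$ be its unique extension to a discrete valuation of $K$. For $g,h\in K^\times$ let $(g,h)_K$ be the quaternion algebra over $K$ generated by $i,j$ with $i^2=g$, $j^2=h$, $ij=-ji$. Let $r,s\in k^\times$. If the biquaternion algebra $$\Delta=(r,x-b)_K\otimes_K(s,x-c)_K$$ is unramified at $w$, i.e. the residue $\rho_w([\Delta])$, a character of the absolute Galois group of the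 residue field of $w$ with values in $\mathbb{Q}/\mathbb{Z}$, is trivial, then $v(r)\equiv v(s)\equiv 0 \pmod 2$. -/

import Mathlib

open scoped Quaternion TensorProduct WithZero Polynomial

noncomputable section

namespace EllipticRamification

/-! ### Ramification of algebras at a discrete valuation -/

/-- The additive (integer) value `w(x)` of a nonzero element `x` for a discrete valuation `w`
written multiplicatively. -/
def ord {F : Type*} [Field F] (w : Valuation F ℤᵐ⁰) (x : F) : ℤ :=
  -WithZero.log (w x)

section Residue

variable {K : Type*} [Field K]

/-- The fixed field, in a separable closure of `K`, of the inertia group of a valuation ring `B`.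
It is the strict henselization of `K` at `B`, that is, the maximal unramified extension of the
henselization (which is the fixed field of the decomposition group). -/
def maxUnramified (B : ValuationSubring (SeparableClosure K)) :
    IntermediateField K (SeparableClosure K) :=
  IntermediateField.fixedField
    ((B.inertiaSubgroup K).map (B.decompositionSubgroup K).subtype)

lemma mem_maxUnramified_iff (B : ValuationSubring (SeparableClosure K)) (x : SeparableClosure K) :
    x ∈ maxUnramified B ↔
      ∀ τ ∈ B.inertiaSubgroup K, (τ : SeparableClosure K ≃ₐ[K] SeparableClosure K) x = x := by
  simp [maxUnramified, IntermediateField.mem_fixedField_iff]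

instance inertia_normal (B : ValuationSubring (SeparableClosure K)) :
    (B.inertiaSubgroup K).Normal :=
  MonoidHom.normal_ker _

lemma decomposition_apply_mem (B : ValuationSubring (SeparableClosure K))
    (σ : B.decompositionSubgroup K) {x : SeparableClosure K} (hx : x ∈ maxUnramified B) :
    (σ : SeparableClosure K ≃ₐ[K] SeparableClosure K) x ∈ maxUnramified B := by
  rw [mem_maxUnramified_iff] at hx ⊢
  intro τ hτ
  have h := hx _ ((inertia_normal B).conj_mem τ hτ σ⁻¹)
  have h2 := congrArg (σ : SeparableClosure K ≃ₐ[K] SeparableClosure K) h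
  rw [← AlgEquiv.mul_apply] at h2 ⊢
  simpa [mul_assoc] using h2

/-- The action of an element of the decomposition group on the maximal unramified extension. -/
def decompositionAct (B : ValuationSubring (SeparableClosure K))
    (σ : B.decompositionSubgroup K) : maxUnramified B →ₐ[K] maxUnramified B :=
  (((σ : SeparableClosure K ≃ₐ[K] SeparableClosure K) :
      SeparableClosure K →ₐ[K] SeparableClosure K).comp (maxUnramified B).val).codRestrict
    (maxUnramified B).toSubalgebra (fun x => decomposition_apply_mem B σ x.2)

/-- The absolute Galois group of the residue field of the restriction of `B` to `K`, realized as
the decomposition group modulo the inertia group. -/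
abbrev ResidueGaloisGroup (B : ValuationSubring (SeparableClosure K)) : Type _ :=
  B.decompositionSubgroup K ⧸ B.inertiaSubgroup K

/-- `χ` is the residue `ρ_w([A])` of the central simple `K`-algebra `A` at the normalized discrete
valuation `w`, where `B` is a valuation ring of the separable closure lying over that of `w`.

Write `L` for the maximal unramified extension. An isomorphism `e : L ⊗ A ≃ M_n(L)` transports
the Galois action `σ ⊗ 1` to a semilinear action on `M_n(L)` of the form
`M ↦ g_σ · σ(M) · g_σ⁻¹` (it is enough to say so on the elements `e (1 ⊗ a)`, which span).
The class of `A` in `H²(Gal, Lˣ)` is that of `c(σ, τ) = g_σ · σ(g_τ) · g_{στ}⁻¹`. Taking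
determinants, `w(c(σ, τ)) = φ(σ) + φ(τ) - φ(στ)` with `φ(σ) = w(det g_σ) / n`, so that
the image of the class under `H²(Gal, Lˣ) → H²(Gal, ℤ) ≃ H¹(Gal, ℚ/ℤ)` is `φ` modulo `ℤ`.

As `L` is unramified over `K`, the value of `det g_σ` is that of some `d` in `K`. -/
def IsResidue (w : Valuation K ℤᵐ⁰) (B : ValuationSubring (SeparableClosure K))
    (A : Type*) [Ring A] [Algebra K A]
    (χ : Additive (ResidueGaloisGroup B) →+ AddCircle (1 : ℚ)) : Prop :=
  ∃ (n : ℕ) (e : (maxUnramified B ⊗[K] A) ≃ₐ[maxUnramified B]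
      Matrix (Fin n) (Fin n) (maxUnramified B)),
    ∀ σ : B.decompositionSubgroup K,
      ∃ (g : GL (Fin n) (maxUnramified B)) (d : K),
        (∀ a : A, e (1 ⊗ₜ[K] a) =
          (g : Matrix (Fin n) (Fin n) (maxUnramified B)) *
            (e (1 ⊗ₜ[K] a)).map (decompositionAct B σ) *
            ((g⁻¹ : GL (Fin n) (maxUnramified B)) :
              Matrix (Fin n) (Fin n) (maxUnramified B))) ∧
        B.valuation (algebraMap K (SeparableClosure K) d) =
          B.valuation (((g : Matrix (Fin n) (Fin n) (maxUnramified B)).det :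
            maxUnramified B) : SeparableClosure K) ∧
        χ (Additive.ofMul (QuotientGroup.mk σ)) =
          (((ord w d : ℚ) / (n : ℚ) : ℚ) : AddCircle (1 : ℚ))

/-- The algebra `A` is unramified at `w`: its residue at `w` is trivial. The residue is computed
with some valuation ring `B` of the separable closure lying over that of `w`; all of these are
conjugate. -/
def IsUnramified (w : Valuation K ℤᵐ⁰) (A : Type*) [Ring A] [Algebra K A] : Prop :=
  ∃ B : ValuationSubring (SeparableClosure K),
    B.comap (algebraMap K (SeparableClosure K)) = w.valuationSubring ∧ IsResidue w B A 0

end Residue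

/-! ### The curve `y² = x³ + α x² + β x + γ` and its function field -/

section Curve

variable {k : Type*} [Field k]

/-- The polynomial `f(x) = x³ + α x² + β x + γ`. -/
def cubic (α β γ : k) : k[X] :=
  Polynomial.X ^ 3 + Polynomial.C α * Polynomial.X ^ 2 + Polynomial.C β * Polynomial.X +
    Polynomial.C γ

/-- The curve `y² = x³ + α x² + β x + γ`. -/
def curve (α β γ : k) : WeierstrassCurve.Affine k where
  a₁ := 0
  a₂ := α
  a₃ := 0
  a₄ := β
  a₆ := γ

/-- The function field `k(x, y)` of the curve. -/
abbrev FunField (α β γ : k) : Type _ := (curve α β γ).FunctionField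

/-- The coordinate function `x`. -/
def xFun (α β γ : k) : FunField α β γ :=
  algebraMap (curve α β γ).CoordinateRing (FunField α β γ)
    (WeierstrassCurve.Affine.CoordinateRing.mk (curve α β γ) (Polynomial.C Polynomial.X))

/-- The coordinate function `y`. -/
def yFun (α β γ : k) : FunField α β γ :=
  algebraMap (curve α β γ).CoordinateRing (FunField α β γ)
    (WeierstrassCurve.Affine.CoordinateRing.mk (curve α β γ) Polynomial.X)

/-- The Gauss extension of `v` on polynomials: in additive notation, the minimum of the values of
the nonzero coefficients. -/
def gauss (v : Valuation k ℤᵐ⁰) (p : k[X]) : ℤᵐ⁰ :=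
  p.support.sup fun i => v (p.coeff i)

/-- `w` is an extension to `k(x, y)` of the Gauss extension of `v` to `k(y)`. (A valuation of the
field `k(y)` is determined by its values on `k[y]`.) -/
def ExtendsGauss {α β γ : k} (v : Valuation k ℤᵐ⁰) (w : Valuation (FunField α β γ) ℤᵐ⁰) : Prop :=
  ∀ p : k[X], w (Polynomial.aeval (yFun α β γ) p) = gauss v p

end Curve

end EllipticRamification

end

/-! Classically, `x - b` and `x - c` are units at `w`, so the residue of the biquaternion algebra is
the product of the quadratic characters of their reductions, raised to the powers `w(r)` and `w(s)`.
On `k` the valuation `w` agrees with `v`. If the two reductions are independent modulo squares in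
the residue field, a trivial residue forces both exponents to be even.

Independence (`one_le_valuation_sq_sub`): since `w` is a Gauss valuation in `y`, the residue of `y`
is transcendental, and the curve equation makes the residue of `x` transcendental too. A congruence
`z² ≡ D(x)`, written with numerators `P + Qy` and denominator `H`, reduces to `P² = D H²` or `f Q² =
D H²` between polynomials over the residue field of `v`. Good reduction keeps the roots of `f`
distinct, so both are excluded by the parity of a root multiplicity, for `D = x - b`, `x - c` and
`(x - b)(x - c)`.

Passing to the residue as defined here: independence gives an element `σ` of the decomposition group
that negates `β = √(x - b)` and fixes `γ = √(x - c)` (`exists_decomposition_apply`). Let `L` be the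
maximal unramified extension. The descent datum at `σ` is a semilinear operator on `L⁴` commuting
with the quaternion generators. In a basis adapted to the eigenvectors of `j₁`, `j₂` its determinant
is `l⁴ r²` for some `l` in `L`, up to a factor that does not change the value
(`exists_det_mul_map_det_eq`). A trivial residue makes this value four times an integer, so `r` has
the value of the square of an element of `L`. If `w(r)` were odd, tame ramification of `√r` would
prevent this (`valuation_sq_ne_of_mem_maxUnramified`). Exchanging the two factors treats `s`.

The Galois elements all come from one source: a closed subgroup acts transitively on the valuation
rings with given trace on its fixed field (`exists_conj_of_fixed_mem_iff`), with a companion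
statement for automorphisms of the residue field (`exists_mem_sub_mem_of_fixed`). -/

noncomputable section

namespace EllipticRamification

/-! ### Conjugacy of valuation rings in an infinite Galois extension -/

section Conjugacy

open scoped Pointwise

variable {K Ω : Type*} [Field K] [Field Ω] [Algebra K Ω]

lemma mem_of_isIntegral (B : ValuationSubring Ω) (A : ValuationSubring K)
    (hB : B.comap (algebraMap K Ω) = A) {x : Ω} (hx : IsIntegral A x) : x ∈ B := by
  have hA : ∀ a : A, algebraMap K Ω a ∈ B := fun a => by
    have : (a : K) ∈ B.comap (algebraMap K Ω) := hB ▸ a.2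
    exact this
  let f : A →+* B := ((algebraMap K Ω).comp A.subtype).codRestrict B.toSubring hA
  obtain ⟨p, hp, hpx⟩ := hx
  have : IsIntegral B x := by
    refine ⟨p.map f, hp.map f, ?_⟩
    rw [Polynomial.eval₂_map]
    exact hpx
  obtain ⟨y, hy⟩ := IsIntegrallyClosed.isIntegral_iff.mp this
  rw [← hy]; exact y.2

/-- The integral closure is the intersection of the valuation rings containing `A`: an element
outside it is excluded by one of them. -/
lemma isIntegral_of_forall_mem (A : ValuationSubring K) {x : Ω}
    (h : ∀ V : ValuationSubring Ω, (∀ a : A, algebraMap K Ω a ∈ V) → x ∈ V) :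
    IsIntegral A x := by
  by_contra hx
  have hint : IsIntegrallyClosedIn (integralClosure A Ω).toSubring Ω :=
    inferInstanceAs (IsIntegrallyClosedIn (integralClosure A Ω) Ω)
  obtain ⟨V, hV, hxV⟩ := Subring.exists_le_valuationSubring_of_isIntegrallyClosedIn
    (R := (integralClosure A Ω).toSubring) (x := x) hx
  exact hxV (h V fun a => hV ((integralClosure A Ω).algebraMap_mem a))

/-- Every element of a valuation ring of an algebraic extension is a fraction of integral elements
whose denominator is a unit of the valuation ring. -/
lemma exists_integral_fraction [Algebra.IsAlgebraic K Ω] (B : ValuationSubring Ω)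
    (A : ValuationSubring K) (hB : B.comap (algebraMap K Ω) = A) {x : Ω} (hx : x ∈ B) :
    ∃ d : Ω, IsIntegral A d ∧ IsIntegral A (d * x) ∧ B.valuation d = 1 := by
  by_cases hx0 : x = 0
  · exact ⟨1, isIntegral_one, by simpa [hx0] using isIntegral_zero, map_one _⟩
  obtain ⟨p, hp0, hpx⟩ := Algebra.IsAlgebraic.isAlgebraic (R := K) x
  -- Dividing by a coefficient of largest value gives a relation over `A` in which some coefficient
  -- is `1`.
  obtain ⟨j, hj, hjmax⟩ := p.support.exists_max_image (fun i => A.valuation (p.coeff i))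
    (Polynomial.support_nonempty.mpr hp0)
  have hcj : p.coeff j ≠ 0 := Polynomial.mem_support_iff.mp hj
  set q : K[X] := Polynomial.C (p.coeff j)⁻¹ * p with hq
  have hqx : Polynomial.aeval x q = 0 := by simp [hq, hpx]
  have hqA : ∀ i, q.coeff i ∈ A := by
    intro i
    rw [← A.valuation_le_one_iff, hq, Polynomial.coeff_C_mul, map_mul, map_inv₀]
    have hpos : 0 < A.valuation (p.coeff j) := zero_lt_iff.mpr ((map_ne_zero _).mpr hcj)
    rw [inv_mul_le_iff₀ hpos, mul_one]
    by_cases hi : i ∈ p.support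
    · exact hjmax i hi
    · rw [Polynomial.notMem_support_iff.mp hi, map_zero]; exact zero_le
  have hqj : q.coeff j = 1 := by simp [hq, hcj]
  set N := q.natDegree
  have hjN : j ≤ N := Polynomial.le_natDegree_of_ne_zero (by simp [hqj])
  -- The relation is cut at its last unit coefficient: `y` collects the terms from degree `i` on and
  -- `z` those below, after division by `x ^ i` and, for `z`, by a further `x⁻¹`.
  obtain ⟨i, hi, himax⟩ := ((Finset.range (N + 1)).filter
    (fun i => A.valuation (q.coeff i) = 1)).exists_max_image id
    ⟨j, by simp [hqj, Nat.lt_succ_of_le hjN]⟩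
  simp only [Finset.mem_filter, Finset.mem_range, id] at hi himax
  have hlt : ∀ m, i < m → m < N + 1 → A.valuation (q.coeff m) < 1 := fun m him hm =>
    lt_of_le_of_ne ((A.valuation_le_one_iff _).mpr (hqA m)) fun h =>
      absurd (himax m ⟨hm, h⟩) (not_le.mpr him)
  set y : Ω := ∑ m ∈ Finset.range (N + 1 - i), algebraMap K Ω (q.coeff (i + m)) * x ^ m with hy
  set z : Ω := ∑ m ∈ Finset.range i, algebraMap K Ω (q.coeff (i - 1 - m)) * x⁻¹ ^ m with hz
  have hyz : y + x⁻¹ * z = 0 := by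
    rw [Polynomial.aeval_eq_sum_range, show q.natDegree + 1 = i + (N + 1 - i) by omega,
      Finset.sum_range_add, ← Finset.sum_range_reflect] at hqx
    have h1 : ∑ m ∈ Finset.range i, q.coeff (i - 1 - m) • x ^ (i - 1 - m) = x ^ i * (x⁻¹ * z) := by
      rw [hz, Finset.mul_sum, Finset.mul_sum]
      refine Finset.sum_congr rfl fun m hm => ?_
      have hm' := Finset.mem_range.mp hm
      rw [Algebra.smul_def]
      have : x ^ i = x ^ (i - 1 - m) * x ^ m * x := by
        rw [← pow_add, ← pow_succ]; congr 1; omega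
      rw [this, inv_pow]
      field_simp
    have h2 : ∑ m ∈ Finset.range (N + 1 - i), q.coeff (i + m) • x ^ (i + m) = x ^ i * y := by
      rw [hy, Finset.mul_sum]
      refine Finset.sum_congr rfl fun m _ => ?_
      rw [Algebra.smul_def, pow_add]; ring
    rw [h1, h2, ← mul_add] at hqx
    rw [add_comm]
    exact (mul_eq_zero.mp hqx).resolve_left (pow_ne_zero _ hx0)
  have hyx : y * x = -z := by
    have : y = -(x⁻¹ * z) := eq_neg_of_add_eq_zero_left hyz
    rw [this]; field_simp
  -- A valuation ring contains `x` or `x⁻¹`. In the first case `y` is visibly in it, in the second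
  -- `z` is; `y * x = -z` links the two.
  have key : ∀ V : ValuationSubring Ω, (∀ a : A, algebraMap K Ω a ∈ V) → y ∈ V ∧ y * x ∈ V := by
    intro V hV
    rcases V.mem_or_inv_mem x with h | h
    · have : y ∈ V := sum_mem fun m _ => mul_mem (hV ⟨_, hqA _⟩) (pow_mem h m)
      exact ⟨this, mul_mem this h⟩
    · have hzV : z ∈ V := sum_mem fun m _ => mul_mem (hV ⟨_, hqA _⟩) (pow_mem h m)
      refine ⟨?_, hyx ▸ neg_mem hzV⟩
      rw [eq_neg_of_add_eq_zero_left hyz]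
      exact neg_mem (mul_mem h hzV)
  refine ⟨y, isIntegral_of_forall_mem A fun V hV => (key V hV).1,
    isIntegral_of_forall_mem A fun V hV => (key V hV).2, ?_⟩
  have hval : ∀ a : K, B.valuation (algebraMap K Ω a) < 1 ↔ A.valuation a < 1 := by
    intro a
    rw [← ValuationSubring.mem_nonunits_iff, ← ValuationSubring.mem_nonunits_iff,
      ValuationSubring.mem_nonunits_iff_or, ValuationSubring.mem_nonunits_iff_or, ← map_inv₀,
      map_eq_zero, ← hB]
    rfl
  have hle : ∀ a ∈ A, B.valuation (algebraMap K Ω a) ≤ 1 := by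
    intro a ha
    rw [B.valuation_le_one_iff]
    rw [← hB] at ha; exact ha
  -- The constant term of `y` is a unit and all later coefficients are non-units, so `y` is a unit
  -- of `B`.
  rw [hy, show N + 1 - i = (N - i) + 1 by omega, Finset.sum_range_succ']
  have h0 : B.valuation (algebraMap K Ω (q.coeff (i + 0)) * x ^ 0) = 1 := by
    rw [pow_zero, mul_one, add_zero]
    refine le_antisymm (hle _ (hqA _)) (not_lt.mp fun h => ?_)
    exact absurd ((hval _).mp h) (by rw [hi.2]; exact lt_irrefl _)
  have h1 : B.valuation (∑ m ∈ Finset.range (N - i),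
      algebraMap K Ω (q.coeff (i + (m + 1))) * x ^ (m + 1)) < 1 := by
    refine Valuation.map_sum_lt _ one_ne_zero fun m hm => ?_
    have hm' := Finset.mem_range.mp hm
    rw [map_mul, map_pow]
    refine mul_lt_one_of_lt_of_le ((hval _).mpr (hlt _ (by omega) (by omega)))
      (pow_le_one' ((B.valuation_le_one_iff _).mpr hx) _)
  rw [Valuation.map_add_eq_of_lt_right _ (by rw [h0]; exact h1), h0]

/-- The center on the integral closure of a valuation ring lying above. -/
def center (B : ValuationSubring Ω) (A : ValuationSubring K)
    (hB : B.comap (algebraMap K Ω) = A) : Ideal (integralClosure A Ω) :=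
  (IsLocalRing.maximalIdeal B).comap
    ((algebraMap (integralClosure A Ω) Ω).codRestrict B.toSubring
      fun x => mem_of_isIntegral B A hB x.2)

lemma mem_center (B : ValuationSubring Ω) (A : ValuationSubring K)
    (hB : B.comap (algebraMap K Ω) = A) (x : integralClosure A Ω) :
    x ∈ center B A hB ↔ B.valuation (x : Ω) < 1 := by
  rw [center, Ideal.mem_comap, ValuationSubring.valuation_lt_one_iff]
  rfl

instance center_isPrime (B : ValuationSubring Ω) (A : ValuationSubring K)
    (hB : B.comap (algebraMap K Ω) = A) : (center B A hB).IsPrime :=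
  Ideal.comap_isPrime _ _

/-- The base ring is the subring fixed by `H` rather than `A`, so that the profinite transitivity
theorem for primes applies to an arbitrary closed subgroup. -/
instance isInvariant_fixedPoints (A : ValuationSubring K) (H : Subgroup (Ω ≃ₐ[K] Ω)) :
    Algebra.IsInvariant (FixedPoints.subring (integralClosure A Ω) H)
      (integralClosure A Ω) H :=
  ⟨fun b hb => ⟨⟨b, hb⟩, rfl⟩⟩

instance smulCommClass_fixedPoints (A : ValuationSubring K) (H : Subgroup (Ω ≃ₐ[K] Ω)) :
    SMulCommClass H (FixedPoints.subring (integralClosure A Ω) H) (integralClosure A Ω) :=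
  ⟨fun h r b => by
    change h • ((r : integralClosure A Ω) * b) = (r : integralClosure A Ω) * h • b
    rw [smul_mul', r.2 h]⟩

lemma continuousSMul_integralClosure [Algebra.IsAlgebraic K Ω] (A : ValuationSubring K)
    (H : Subgroup (Ω ≃ₐ[K] Ω)) [TopologicalSpace (integralClosure A Ω)]
    [DiscreteTopology (integralClosure A Ω)] : ContinuousSMul H (integralClosure A Ω) := by
  rw [continuousSMul_iff_stabilizer_isOpen]
  intro x
  have h := (stabilizer_isOpen_of_isIntegral (K := K) (x : Ω)).preimage
    (continuous_subtype_val : Continuous ((↑) : H → (Ω ≃ₐ[K] Ω)))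
  convert h using 1
  ext g
  simp only [SetLike.mem_coe, MulAction.mem_stabilizer_iff, Set.mem_preimage, Subtype.ext_iff]
  rfl

lemma valuation_lt_one_iff_of_mem_iff {B₁ B₂ : ValuationSubring Ω} {x : Ω}
    (h : x⁻¹ ∈ B₁ ↔ x⁻¹ ∈ B₂) : B₁.valuation x < 1 ↔ B₂.valuation x < 1 := by
  rw [← ValuationSubring.mem_nonunits_iff, ← ValuationSubring.mem_nonunits_iff,
      ValuationSubring.mem_nonunits_iff_or, ValuationSubring.mem_nonunits_iff_or, h]

lemma valuation_apply_lt_one_iff {B : ValuationSubring Ω} {θ : Ω ≃ₐ[K] Ω}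
    (hθ : ∀ x, θ x ∈ B ↔ x ∈ B) (x : Ω) : B.valuation (θ x) < 1 ↔ B.valuation x < 1 := by
  rw [← ValuationSubring.mem_nonunits_iff, ← ValuationSubring.mem_nonunits_iff,
    ValuationSubring.mem_nonunits_iff_or, ValuationSubring.mem_nonunits_iff_or, ← map_inv₀, hθ,
    map_eq_zero]

/-- A closed subgroup of the Galois group acts transitively on the valuation rings with a given
trace on the fixed field of the subgroup. -/
theorem exists_conj_of_fixed_mem_iff [IsGalois K Ω] (B₁ B₂ : ValuationSubring Ω)
    (A : ValuationSubring K) (hB₁ : B₁.comap (algebraMap K Ω) = A)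
    (hB₂ : B₂.comap (algebraMap K Ω) = A)
    (H : Subgroup (Ω ≃ₐ[K] Ω)) (hH : IsClosed (H : Set (Ω ≃ₐ[K] Ω)))
    (hfix : ∀ x : Ω, (∀ h ∈ H, h x = x) → (x ∈ B₁ ↔ x ∈ B₂)) :
    ∃ h ∈ H, ∀ x, x ∈ B₁ ↔ h x ∈ B₂ := by
  let _ : TopologicalSpace (integralClosure A Ω) := ⊥
  have : DiscreteTopology (integralClosure A Ω) := ⟨rfl⟩
  have := continuousSMul_integralClosure A H
  have : CompactSpace H := isCompact_iff_compactSpace.mp hH.isCompact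
  obtain ⟨h, hh⟩ := Algebra.IsInvariant.exists_smul_of_under_eq_of_profinite
    (A := FixedPoints.subring (integralClosure A Ω) H) (G := H)
    (center B₁ A hB₁) (center B₂ A hB₂) (by
      ext ⟨x, hx⟩
      change x ∈ center B₁ A hB₁ ↔ x ∈ center B₂ A hB₂
      rw [mem_center, mem_center]
      -- The hypothesis speaks of membership in the rings; applied to `x⁻¹` it compares the maximal
      -- ideals.
      refine valuation_lt_one_iff_of_mem_iff (hfix _ fun h hh => ?_)
      rw [map_inv₀]
      congr 1
      exact congrArg Subtype.val (hx ⟨h, hh⟩))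
  have hval : ∀ d : Ω, IsIntegral A d →
      (B₁.valuation d < 1 ↔ B₂.valuation ((h : Ω ≃ₐ[K] Ω) d) < 1) := by
    intro d hd
    have h1 : h • (⟨d, hd⟩ : integralClosure A Ω) ∈ center B₂ A hB₂ ↔
        (⟨d, hd⟩ : integralClosure A Ω) ∈ center B₁ A hB₁ := by
      rw [hh, Ideal.smul_mem_pointwise_smul_iff]
    rw [mem_center, mem_center] at h1
    exact h1.symm
  have hint : ∀ (g : Ω ≃ₐ[K] Ω) (d : Ω), IsIntegral A d → IsIntegral A (g d) := fun g d hd =>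
    hd.map (MulSemiringAction.toAlgHom A Ω g)
  have hone : ∀ (B : ValuationSubring Ω) (_ : B.comap (algebraMap K Ω) = A) (d : Ω),
      IsIntegral A d → (B.valuation d = 1 ↔ ¬ B.valuation d < 1) := fun B hB d hd =>
    ⟨fun h => h ▸ lt_irrefl _, fun h => le_antisymm
      ((B.valuation_le_one_iff d).mpr (mem_of_isIntegral B A hB hd)) (not_lt.mp h)⟩
  have hmem : ∀ (B : ValuationSubring Ω) (_ : B.comap (algebraMap K Ω) = A) (d x : Ω),
      B.valuation d = 1 → IsIntegral A (d * x) → x ∈ B := fun B hB d x hd hdx => by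
    have := (B.valuation_le_one_iff _).mpr (mem_of_isIntegral B A hB hdx)
    rwa [map_mul, hd, one_mul, B.valuation_le_one_iff] at this
  refine ⟨h, h.2, fun x => ⟨fun hx => ?_, fun hx => ?_⟩⟩
  -- The conjugating element matches only the centers; fractions with unit denominator recover the
  -- whole valuation rings from them.
  · obtain ⟨d, hd, hdx, hd1⟩ := exists_integral_fraction B₁ A hB₁ hx
    refine hmem B₂ hB₂ ((h : Ω ≃ₐ[K] Ω) d) _ ?_ (by rw [← map_mul]; exact hint _ _ hdx)
    rwa [hone B₂ hB₂ _ (hint _ _ hd), ← hval d hd, ← hone B₁ hB₁ d hd]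
  · obtain ⟨d, hd, hdx, hd1⟩ := exists_integral_fraction B₂ A hB₂ hx
    have e : ∀ y, (h : Ω ≃ₐ[K] Ω) ((h : Ω ≃ₐ[K] Ω).symm y) = y :=
      (h : Ω ≃ₐ[K] Ω).apply_symm_apply
    have hd' := hint (h : Ω ≃ₐ[K] Ω).symm _ hd
    refine hmem B₁ hB₁ ((h : Ω ≃ₐ[K] Ω).symm d) _ ?_ ?_
    · rwa [hone B₁ hB₁ _ hd', hval _ hd', e, ← hone B₂ hB₂ d hd]
    · have := hint (h : Ω ≃ₐ[K] Ω).symm _ hdx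
      rwa [map_mul, AlgEquiv.symm_apply_apply] at this

/-- An automorphism of the residue field of `B` induced by the decomposition group and trivial on
the trace of `B` on the fixed field of a closed subgroup `H` is induced by an element of `H`. -/
theorem exists_mem_sub_mem_of_fixed [IsGalois K Ω] (B : ValuationSubring Ω)
    (A : ValuationSubring K) (hB : B.comap (algebraMap K Ω) = A)
    (H : Subgroup (Ω ≃ₐ[K] Ω)) (hH : IsClosed (H : Set (Ω ≃ₐ[K] Ω)))
    (θ : Ω ≃ₐ[K] Ω) (hθ : ∀ x, θ x ∈ B ↔ x ∈ B)
    (hfix : ∀ x ∈ B, (∀ h ∈ H, h x = x) → B.valuation (θ x - x) < 1) :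
    ∃ h ∈ H, (∀ x, x ∈ B ↔ h x ∈ B) ∧ ∀ x ∈ B, B.valuation (h x - θ x) < 1 := by
  let _ : TopologicalSpace (integralClosure A Ω) := ⊥
  have : DiscreteTopology (integralClosure A Ω) := ⟨rfl⟩
  have := continuousSMul_integralClosure A H
  have : CompactSpace H := isCompact_iff_compactSpace.mp hH.isCompact
  set Q := center B A hB
  have hQθ : θ • Q = Q := by
    ext x
    rw [Ideal.mem_pointwise_smul_iff_inv_smul_mem, mem_center, mem_center]
    rw [← valuation_apply_lt_one_iff hθ]
    have : θ ((θ⁻¹ • x : integralClosure A Ω) : Ω) = (x : Ω) := θ.apply_symm_apply (x : Ω)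
    rw [this]
  let e₀ := Ideal.Quotient.stabilizerHom Q (Q.under A) (Ω ≃ₐ[K] Ω) ⟨θ, hQθ⟩
  let R := FixedPoints.subring (integralClosure A Ω) H
  -- The automorphism that `θ` induces modulo `Q` is linear over the trace of `Q` on the fixed ring,
  -- which is what `hfix` provides. It therefore lifts to the stabilizer of `Q` in `H`.
  let e : (integralClosure A Ω ⧸ Q) ≃ₐ[R ⧸ Q.under R] (integralClosure A Ω ⧸ Q) :=
    AlgEquiv.ofRingEquiv (f := e₀.toRingEquiv) (by
      intro r
      obtain ⟨⟨r, hr⟩, rfl⟩ := Ideal.Quotient.mk_surjective r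
      change Ideal.Quotient.mk Q (θ • r) = Ideal.Quotient.mk Q r
      rw [Ideal.Quotient.eq, mem_center]
      exact hfix _ (mem_of_isIntegral B A hB r.2)
        fun h hh => congrArg Subtype.val (hr ⟨h, hh⟩))
  obtain ⟨⟨h, hhQ⟩, hh⟩ := Ideal.Quotient.stabilizerHom_surjective_of_profinite
    (G := H) (Q.under R) Q e
  have hC : ∀ x : Ω, IsIntegral A x → B.valuation ((h : Ω ≃ₐ[K] Ω) x - θ x) < 1 := by
    intro x hx
    have h1 := DFunLike.congr_fun hh (Ideal.Quotient.mk Q ⟨x, hx⟩)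
    have h2 : Ideal.Quotient.mk Q (h • (⟨x, hx⟩ : integralClosure A Ω)) =
        Ideal.Quotient.mk Q (θ • (⟨x, hx⟩ : integralClosure A Ω)) := h1
    rw [Ideal.Quotient.eq, mem_center] at h2
    exact h2
  have hint : ∀ (g : Ω ≃ₐ[K] Ω) (d : Ω), IsIntegral A d → IsIntegral A (g d) := fun g d hd =>
    hd.map (MulSemiringAction.toAlgHom A Ω g)
  have hθ1 : ∀ x, B.valuation (θ x) = 1 ↔ B.valuation x = 1 := by
    intro x
    have h1 := (B.valuation_le_one_iff (θ x)).trans ((hθ x).trans (B.valuation_le_one_iff x).symm)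
    rw [eq_iff_le_not_lt, eq_iff_le_not_lt, h1, valuation_apply_lt_one_iff hθ]
  have hunit : ∀ d : Ω, IsIntegral A d → B.valuation d = 1 →
      B.valuation ((h : Ω ≃ₐ[K] Ω) d) = 1 := by
    intro d hd hd1
    have : (h : Ω ≃ₐ[K] Ω) d = θ d + ((h : Ω ≃ₐ[K] Ω) d - θ d) := by ring
    rw [this, Valuation.map_add_eq_of_lt_left, (hθ1 d).mpr hd1]
    rw [(hθ1 d).mpr hd1]; exact hC d hd
  have hsub : ∀ x ∈ B, (h : Ω ≃ₐ[K] Ω) x ∈ B ∧ B.valuation ((h : Ω ≃ₐ[K] Ω) x - θ x) < 1 := by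
    intro x hx
    obtain ⟨d, hd, hdx, hd1⟩ := exists_integral_fraction B A hB hx
    have h1 := hC d hd
    have h2 := hC _ hdx
    have hu := hunit d hd hd1
    have hxB : (h : Ω ≃ₐ[K] Ω) x ∈ B := by
      rw [← B.valuation_le_one_iff]
      have := (B.valuation_le_one_iff _).mpr
        (mem_of_isIntegral B A hB (hint (h : Ω ≃ₐ[K] Ω) _ hdx))
      rwa [map_mul, map_mul, hu, one_mul] at this
    refine ⟨hxB, ?_⟩
    -- This identity carries the congruence from the integral elements `d` and `d * x` to `x`, since
    -- `h d` is a unit.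
    have hid : (h : Ω ≃ₐ[K] Ω) d * ((h : Ω ≃ₐ[K] Ω) x - θ x) =
        ((h : Ω ≃ₐ[K] Ω) (d * x) - θ (d * x)) - ((h : Ω ≃ₐ[K] Ω) d - θ d) * θ x := by
      simp only [map_mul]; ring
    rw [← one_mul (B.valuation (_ - θ x)), ← hu, ← map_mul, hid, hu]
    refine Valuation.map_sub_lt _ h2 ?_
    rw [map_mul]
    exact mul_lt_one_of_lt_of_le h1 ((B.valuation_le_one_iff _).mpr ((hθ x).mpr hx))
  refine ⟨h, h.2, fun x => ⟨fun hx => (hsub x hx).1, fun hx => ?_⟩, fun x hx => (hsub x hx).2⟩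
  by_contra hxB
  have hxi : B.valuation x⁻¹ < 1 := by
    rw [← ValuationSubring.mem_nonunits_iff, ValuationSubring.mem_nonunits_iff_or, inv_inv]
    exact Or.inr hxB
  have h1 := hsub x⁻¹ ((B.valuation_le_one_iff _).mp hxi.le)
  have h2 : B.valuation (θ x⁻¹) < 1 := by
    rw [← ValuationSubring.mem_nonunits_iff, ValuationSubring.mem_nonunits_iff_or, ← map_inv₀,
      inv_inv, hθ]
    exact Or.inr hxB
  have h3 : B.valuation ((h : Ω ≃ₐ[K] Ω) x⁻¹) < 1 := by
    rw [← sub_add_cancel ((h : Ω ≃ₐ[K] Ω) x⁻¹) (θ x⁻¹)]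
    exact Valuation.map_add_lt _ h1.2 h2
  rw [← ValuationSubring.mem_nonunits_iff, ValuationSubring.mem_nonunits_iff_or, ← map_inv₀,
      inv_inv] at h3
  rcases h3 with h3 | h3
  · rw [map_eq_zero, inv_eq_zero] at h3
    exact hxB (h3 ▸ B.zero_mem)
  · exact h3 hx

end Conjugacy

/-! ### Quadratic subextensions and the action of the decomposition group -/

section Quadratic

open scoped Pointwise

variable {K Ω : Type*} [Field K] [Field Ω] [Algebra K Ω]

lemma inv_apply_eq_neg {g : Ω ≃ₐ[K] Ω} {s : Ω} (hg : g s = -s) : g⁻¹ s = -s := by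
  refine g.injective ?_
  rw [map_neg, hg, neg_neg]
  exact g.apply_symm_apply s

/-- The stabilizer of `s` has index two in `G`, and `τ` represents the other coset; `a` and `b * s`
are the even and odd parts of `x` under `τ`. -/
lemma exists_eq_add_mul_of_fixed (h2 : (2 : Ω) ≠ 0) (G : Subgroup (Ω ≃ₐ[K] Ω)) {s : Ω} (hs : s ≠ 0)
    (hG : ∀ g ∈ G, g s = s ∨ g s = -s) {τ : Ω ≃ₐ[K] Ω} (hτG : τ ∈ G) (hτ : τ s = -s) {x : Ω}
    (hx : ∀ g ∈ G, g s = s → g x = x) :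
    ∃ a b : Ω, (∀ g ∈ G, g a = a) ∧ (∀ g ∈ G, g b = b) ∧ x = a + b * s := by
  have hτi : τ⁻¹ s = -s := inv_apply_eq_neg hτ
  have e : ∀ y, τ (τ⁻¹ y) = y := τ.apply_symm_apply
  have h1 : ∀ g ∈ G, g s = s → g (τ x) = τ x := by
    intro g hg hgs
    have := hx (τ⁻¹ * g * τ) (mul_mem (mul_mem (inv_mem hτG) hg) hτG) (by
      rw [AlgEquiv.mul_apply, AlgEquiv.mul_apply, hτ, map_neg, hgs, map_neg, hτi, neg_neg])
    rw [AlgEquiv.mul_apply, AlgEquiv.mul_apply] at this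
    rw [← e (g (τ x)), this]
  have h3 : ∀ g ∈ G, g s = -s → g x = τ x := by
    intro g hg hgs
    have := hx (τ⁻¹ * g) (mul_mem (inv_mem hτG) hg) (by
      rw [AlgEquiv.mul_apply, hgs, map_neg, hτi, neg_neg])
    rw [AlgEquiv.mul_apply] at this
    rw [← e (g x), this]
  have h4 : ∀ g ∈ G, g s = -s → g (τ x) = x := by
    intro g hg hgs
    exact hx (g * τ) (mul_mem hg hτG) (by
      rw [AlgEquiv.mul_apply, hτ, map_neg, hgs, neg_neg])
  refine ⟨(x + τ x) / 2, (x - τ x) / (2 * s), fun g hg => ?_, fun g hg => ?_, ?_⟩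
  · rcases hG g hg with h | h
    · rw [map_div₀, map_add, hx g hg h, h1 g hg h, map_ofNat]
    · rw [map_div₀, map_add, h3 g hg h, h4 g hg h, map_ofNat, add_comm]
  · rcases hG g hg with h | h
    · rw [map_div₀, map_sub, hx g hg h, h1 g hg h, map_mul, map_ofNat, h]
    · rw [map_div₀, map_sub, h3 g hg h, h4 g hg h, map_mul, map_ofNat, h]
      field_simp; ring
  · field_simp; ring

lemma apply_eq_or_eq_neg {g : Ω ≃ₐ[K] Ω} {s : Ω} (h : g (s ^ 2) = s ^ 2) : g s = s ∨ g s = -s := by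
  rw [map_pow] at h
  exact sq_eq_sq_iff_eq_or_eq_neg.mp h

lemma mem_range_of_fixed [IsGalois K Ω] {x : Ω} (h : ∀ g : Ω ≃ₐ[K] Ω, g x = x) :
    ∃ a : K, algebraMap K Ω a = x :=
  IntermediateField.mem_bot.mp ((InfiniteGalois.mem_bot_iff_fixed x).mpr h)

lemma isClosed_stabilizer [Algebra.IsAlgebraic K Ω] (s : Ω) :
    IsClosed (MulAction.stabilizer (Ω ≃ₐ[K] Ω) s : Set (Ω ≃ₐ[K] Ω)) :=
  Subgroup.isClosed_of_isOpen _ (stabilizer_isOpen_of_isIntegral s)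

lemma mem_decompositionSubgroup_iff (B : ValuationSubring Ω) (σ : Ω ≃ₐ[K] Ω) :
    σ ∈ B.decompositionSubgroup K ↔ ∀ x, x ∈ B ↔ σ x ∈ B := by
  rw [MulAction.mem_stabilizer_iff]
  constructor
  · intro h x
    constructor
    · intro hx
      rw [← h]
      exact ValuationSubring.smul_mem_pointwise_smul σ x B hx
    · intro hx
      rw [← h, ValuationSubring.mem_smul_pointwise_iff_exists] at hx
      obtain ⟨y, hy, hyx⟩ := hx
      exact σ.injective hyx ▸ hy
  · intro h
    ext x
    rw [ValuationSubring.mem_smul_pointwise_iff_exists]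
    constructor
    · rintro ⟨y, hy, rfl⟩
      exact (h y).mp hy
    · intro hx
      refine ⟨σ.symm x, (h _).mpr (by rwa [AlgEquiv.apply_symm_apply]), σ.apply_symm_apply x⟩

lemma mem_inertiaSubgroup_iff (B : ValuationSubring Ω) (τ : B.decompositionSubgroup K) :
    τ ∈ B.inertiaSubgroup K ↔ ∀ x ∈ B, B.valuation ((τ : Ω ≃ₐ[K] Ω) x - x) < 1 := by
  have key : ∀ x : B, (IsLocalRing.residue B (τ • x) = IsLocalRing.residue B x) ↔
      B.valuation ((τ : Ω ≃ₐ[K] Ω) (x : Ω) - x) < 1 := by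
    intro x
    rw [← sub_eq_zero, ← map_sub, IsLocalRing.residue_eq_zero_iff,
      ValuationSubring.valuation_lt_one_iff]
    rfl
  rw [ValuationSubring.inertiaSubgroup, MonoidHom.mem_ker]
  constructor
  · intro h x hx
    rw [← key ⟨x, hx⟩, IsLocalRing.ResidueField.residue_smul]
    exact DFunLike.congr_fun h (IsLocalRing.residue B ⟨x, hx⟩)
  · intro h
    ext x
    obtain ⟨x, rfl⟩ := IsLocalRing.residue_surjective x
    exact (IsLocalRing.ResidueField.residue_smul _ _ _).symm.trans ((key x).mpr (h x x.2))

/-- Preserving `B` gives preservation of the order on values only. As `σ` permutes the finitely many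
conjugates of `x`, the orbit of `x` is periodic, and a strict inequality between the values of `x`
and `σ x` would propagate to a strictly monotone periodic sequence. -/
lemma valuation_apply_of_decomposition [Algebra.IsAlgebraic K Ω] (B : ValuationSubring Ω)
    {σ : Ω ≃ₐ[K] Ω} (h : ∀ x, x ∈ B ↔ σ x ∈ B) (x : Ω) :
    B.valuation (σ x) = B.valuation x := by
  by_cases hx0 : x = 0
  · rw [hx0, map_zero]
  have hlt : ∀ a b : Ω, b ≠ 0 → (B.valuation (σ a) < B.valuation (σ b) ↔
      B.valuation a < B.valuation b) := by
    intro a b hb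
    have := valuation_apply_lt_one_iff (fun x => (h x).symm) (a / b)
    rwa [map_div₀, map_div₀, map_div₀, div_lt_one₀ (zero_lt_iff.mpr ((map_ne_zero _).mpr hb)),
      div_lt_one₀ (zero_lt_iff.mpr ((map_ne_zero _).mpr (by simpa using hb)))] at this
  have hfin : ((minpoly K x).rootSet Ω).Finite := Polynomial.rootSet_finite _ _
  have hmaps : Set.MapsTo σ ((minpoly K x).rootSet Ω) ((minpoly K x).rootSet Ω) := by
    intro y hy
    rw [Polynomial.mem_rootSet] at hy ⊢
    refine ⟨hy.1, ?_⟩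
    change Polynomial.aeval ((σ : Ω →ₐ[K] Ω) y) _ = 0
    rw [Polynomial.aeval_algHom_apply, hy.2, map_zero]
  have hxroot : x ∈ (minpoly K x).rootSet Ω := by
    rw [Polynomial.mem_rootSet]
    exact ⟨minpoly.ne_zero (Algebra.IsIntegral.isIntegral x), minpoly.aeval K x⟩
  have : Finite ((minpoly K x).rootSet Ω) := hfin
  obtain ⟨m, hm, hper⟩ := (hmaps.restrict_inj.mpr σ.injective.injOn).mem_periodicPts ⟨x, hxroot⟩
  have hper' : (⇑σ)^[m] x = x := by
    have h1 := congrArg Subtype.val hper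
    rwa [Set.MapsTo.iterate_restrict, Set.MapsTo.val_restrict_apply] at h1
  have hit0 : ∀ n, (⇑σ)^[n] x ≠ 0 := by
    intro n
    induction n with
    | zero => exact hx0
    | succ n ih => rw [Function.iterate_succ_apply']; simpa using ih
  have hiter : ∀ n, (B.valuation (σ ((⇑σ)^[n] x)) < B.valuation ((⇑σ)^[n] x) ↔
      B.valuation (σ x) < B.valuation x) ∧ (B.valuation ((⇑σ)^[n] x) <
      B.valuation (σ ((⇑σ)^[n] x)) ↔ B.valuation x < B.valuation (σ x)) := by
    intro n
    induction n with
    | zero => exact ⟨Iff.rfl, Iff.rfl⟩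
    | succ n ih =>
      have h1 : σ ((⇑σ)^[n] x) ≠ 0 := by simpa using hit0 n
      rw [Function.iterate_succ_apply', hlt _ _ (hit0 n), hlt _ _ h1]
      exact ih
  rcases lt_trichotomy (B.valuation (σ x)) (B.valuation x) with hl | he | hg
  · have hanti : StrictAnti fun n => B.valuation ((⇑σ)^[n] x) := strictAnti_nat_of_succ_lt fun n => by
      rw [Function.iterate_succ_apply']
      exact (hiter n).1.mpr hl
    have := hanti hm
    simp [hper'] at this
  · exact he
  · have hmono : StrictMono fun n => B.valuation ((⇑σ)^[n] x) := strictMono_nat_of_lt_succ fun n => by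
      rw [Function.iterate_succ_apply']
      exact (hiter n).2.mpr hg
    have := hmono hm
    simp [hper'] at this

end Quadratic

/-! ### Inertia acts on square roots of elements of odd value -/

section Ramification

variable {K Ω : Type*} [Field K] [Field Ω] [Algebra K Ω]

/-- If the uniformizer `π` has residue characteristic prime to `2`, some element of the inertia
group moves its square root. -/
lemma exists_inertia_apply_eq_neg [IsGalois K Ω] (B : ValuationSubring Ω)
    (h2 : B.valuation (2 : Ω) = 1) {s : Ω} {π : K} (hs : s ^ 2 = algebraMap K Ω π)
    (hπ : ∀ a : K, B.valuation (algebraMap K Ω a) ^ 2 ≠ B.valuation (algebraMap K Ω π)) :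
    ∃ τ ∈ B.inertiaSubgroup K, (τ : Ω ≃ₐ[K] Ω) s = -s := by
  have h20 : (2 : Ω) ≠ 0 := fun h => by rw [h, map_zero] at h2; exact zero_ne_one h2
  have hvs : B.valuation s ^ 2 = B.valuation (algebraMap K Ω π) := by rw [← map_pow, hs]
  have hs0 : s ≠ 0 := by
    rintro rfl
    exact hπ 0 (by rw [← hvs, map_zero])
  have hpm : ∀ g : Ω ≃ₐ[K] Ω, g s = s ∨ g s = -s := fun g => apply_eq_or_eq_neg (by
    rw [hs, AlgEquiv.commutes])
  obtain ⟨τ₀, hτ₀⟩ : ∃ τ : Ω ≃ₐ[K] Ω, τ s = -s := by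
    by_contra hcon
    push Not at hcon
    obtain ⟨a, ha⟩ := mem_range_of_fixed fun g => (hpm g).resolve_right (hcon g)
    exact hπ a (by rw [ha, hvs])
  have hdist : ∀ a b : K, b ≠ 0 → B.valuation (algebraMap K Ω a) ≠
      B.valuation (algebraMap K Ω b * s) := by
    intro a b hb hab
    have hb' : B.valuation (algebraMap K Ω b) ≠ 0 := by simpa using hb
    refine hπ (a / b) ?_
    rw [map_div₀, map_div₀, hab, map_mul, mul_div_cancel_left₀ _ hb', hvs]
  -- The values of `K` and of `K * s` are disjoint, so no cancellation occurs in `K(s)`, and the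
  -- trace of `B` there is stable under `s ↦ -s`.
  have hmax : ∀ a b : K, B.valuation (algebraMap K Ω a + algebraMap K Ω b * s) =
      max (B.valuation (algebraMap K Ω a)) (B.valuation (algebraMap K Ω b * s)) := by
    intro a b
    by_cases hb : b = 0
    · simp [hb]
    · exact Valuation.map_add_of_distinct_val _ (hdist a b hb)
  set H := MulAction.stabilizer (Ω ≃ₐ[K] Ω) s
  have hquad : ∀ x : Ω, (∀ h ∈ H, h x = x) →
      ∃ a b : K, x = algebraMap K Ω a + algebraMap K Ω b * s := by
    intro x hx
    obtain ⟨a, b, ha, hb, hab⟩ := exists_eq_add_mul_of_fixed h20 ⊤ hs0 (fun g _ => hpm g)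
      (Subgroup.mem_top τ₀) hτ₀ (fun g _ hg => hx g hg)
    obtain ⟨a, rfl⟩ := mem_range_of_fixed fun g => ha g (Subgroup.mem_top g)
    obtain ⟨b, rfl⟩ := mem_range_of_fixed fun g => hb g (Subgroup.mem_top g)
    exact ⟨a, b, hab⟩
  have hneg : ∀ (a b : K) (g : Ω ≃ₐ[K] Ω), g s = -s →
      g (algebraMap K Ω a + algebraMap K Ω b * s) =
        algebraMap K Ω a + algebraMap K Ω (-b) * s := by
    intro a b g hg
    rw [map_add, map_mul, AlgEquiv.commutes, AlgEquiv.commutes, hg, map_neg]; ring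
  obtain ⟨h, hh, hhB⟩ := exists_conj_of_fixed_mem_iff (B.comap (τ₀ : Ω →+* Ω)) B
    (B.comap (algebraMap K Ω)) (by
      ext x
      change τ₀ (algebraMap K Ω x) ∈ B ↔ algebraMap K Ω x ∈ B
      rw [AlgEquiv.commutes]) rfl H (isClosed_stabilizer s) (by
      intro x hx
      obtain ⟨a, b, rfl⟩ := hquad x hx
      change τ₀ _ ∈ B ↔ _
      rw [hneg a b τ₀ hτ₀, ← B.valuation_le_one_iff, ← B.valuation_le_one_iff, hmax, hmax,
        map_neg, neg_mul, Valuation.map_neg])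
  have hhB' : ∀ x, τ₀ x ∈ B ↔ h x ∈ B := hhB
  have hτ₀e : ∀ y, τ₀ (τ₀⁻¹ y) = y := τ₀.apply_symm_apply
  set θ := h * τ₀⁻¹ with hθdef
  have hθ : ∀ x, θ x ∈ B ↔ x ∈ B := by
    intro x
    rw [hθdef, AlgEquiv.mul_apply, ← hhB', hτ₀e]
  have hθs : θ s = -s := by
    rw [hθdef, AlgEquiv.mul_apply, inv_apply_eq_neg hτ₀, map_neg]
    exact congrArg _ hh
  -- `K(s)` has no residue extension: in `a + b * s` integral at `B`, the term `b * s` lies in the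
  -- maximal ideal. So `θ` acts trivially on that residue field, and its residue action is matched
  -- by some `g` fixing `s`. Then `g⁻¹ * θ` is inertial and still negates `s`.
  obtain ⟨g, hg, hgB, hgθ⟩ := exists_mem_sub_mem_of_fixed B (B.comap (algebraMap K Ω)) rfl H
    (isClosed_stabilizer s) θ hθ (by
      intro x hxB hx
      obtain ⟨a, b, rfl⟩ := hquad x hx
      rw [hneg a b θ hθs]
      rw [← B.valuation_le_one_iff, hmax] at hxB
      have hid : algebraMap K Ω a + algebraMap K Ω (-b) * s -
          (algebraMap K Ω a + algebraMap K Ω b * s) = -(2 * (algebraMap K Ω b * s)) := by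
        rw [map_neg]; ring
      rw [hid, Valuation.map_neg, map_mul, h2, one_mul]
      refine lt_of_le_of_ne ((le_max_right _ _).trans hxB) fun h1 => ?_
      by_cases hb : b = 0
      · rw [hb, map_zero, zero_mul, map_zero] at h1
        exact zero_ne_one h1
      · exact hdist 1 b hb (by rw [h1, map_one, map_one]))
  have hge : ∀ y, g (g⁻¹ y) = y := g.apply_symm_apply
  have hgB' : ∀ x, g⁻¹ x ∈ B ↔ x ∈ B := fun x => by rw [hgB, hge]
  have hgs : g⁻¹ s = s := by
    have : g s = s := hg
    conv_lhs => rw [← this]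
    exact g.symm_apply_apply s
  have hdec : g⁻¹ * θ ∈ B.decompositionSubgroup K := by
    rw [mem_decompositionSubgroup_iff]
    intro x
    rw [AlgEquiv.mul_apply, hgB', hθ]
  refine ⟨⟨g⁻¹ * θ, hdec⟩, (mem_inertiaSubgroup_iff B _).mpr fun x hx => ?_, ?_⟩
  · have hid : (g⁻¹ * θ) x - x = g⁻¹ (-(g x - θ x)) := by
      rw [AlgEquiv.mul_apply, neg_sub, map_sub]
      congr 1
      exact (g.symm_apply_apply x).symm
    change B.valuation ((g⁻¹ * θ) x - x) < 1
    rw [hid, valuation_apply_lt_one_iff hgB', Valuation.map_neg]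
    exact hgθ x hx
  · change (g⁻¹ * θ) s = -s
    rw [AlgEquiv.mul_apply, hθs, map_neg, hgs]

end Ramification

/-! ### Square roots in the maximal unramified extension -/

section SepClosure

variable {K : Type*} [Field K]

/-- The maximal unramified extension has no element of half-integral value. -/
lemma valuation_sq_ne_of_mem_maxUnramified (B : ValuationSubring (SeparableClosure K))
    (h2 : B.valuation (2 : SeparableClosure K) = 1) {π : K}
    (hπ : ∀ a : K, B.valuation (algebraMap K _ a) ^ 2 ≠ B.valuation (algebraMap K _ π))
    {l : SeparableClosure K} (hl : l ∈ maxUnramified B) :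
    B.valuation l ^ 2 ≠ B.valuation (algebraMap K _ π) := by
  intro hlπ
  have h20 : (2 : SeparableClosure K) ≠ 0 := fun h => by
    rw [h, map_zero] at h2; exact zero_ne_one h2
  have : NeZero (2 : SeparableClosure K) := ⟨h20⟩
  obtain ⟨s, hs⟩ := IsSepClosed.exists_pow_nat_eq (algebraMap K (SeparableClosure K) π) 2
  obtain ⟨τ, hτ, hτs⟩ := exists_inertia_apply_eq_neg B h2 hs hπ
  have hτl := (mem_maxUnramified_iff B l).mp hl τ hτ
  have hval : B.valuation l = B.valuation s := by
    rw [← hs, map_pow] at hlπ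
    exact (pow_left_inj₀ zero_le zero_le two_ne_zero).mp hlπ
  have hs0 : B.valuation s ≠ 0 := by
    intro h
    refine hπ 0 ?_
    rw [← hs, map_pow, h, map_zero, map_zero]
  -- The inertial `τ` fixes `l` and negates `s`, so it negates the unit `l / s`. Inertia acts
  -- trivially on residues and `2` is a unit, a contradiction.
  have h1 : B.valuation (l / s) = 1 := by rw [map_div₀, hval, div_self hs0]
  have h3 := (mem_inertiaSubgroup_iff B τ).mp hτ (l / s) ((B.valuation_le_one_iff _).mp h1.le)
  have hid : (τ : SeparableClosure K ≃ₐ[K] SeparableClosure K) (l / s) - l / s =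
      -(2 * (l / s)) := by
    rw [map_div₀, hτl, hτs]; ring
  rw [hid, Valuation.map_neg, map_mul, h2, h1, one_mul] at h3
  exact lt_irrefl _ h3

/-- Square roots of units are unramified in residue characteristic different from `2`. -/
lemma mem_maxUnramified_of_sq (B : ValuationSubring (SeparableClosure K))
    (h2 : B.valuation (2 : SeparableClosure K) = 1) {s : SeparableClosure K}
    (hs : B.valuation s = 1) {u : K} (hu : s ^ 2 = algebraMap K _ u) : s ∈ maxUnramified B := by
  rw [mem_maxUnramified_iff]
  intro τ hτ
  refine (apply_eq_or_eq_neg (by rw [hu, AlgEquiv.commutes])).resolve_right fun h => ?_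
  have h3 := (mem_inertiaSubgroup_iff B τ).mp hτ s ((B.valuation_le_one_iff _).mp hs.le)
  have hid : (τ : SeparableClosure K ≃ₐ[K] SeparableClosure K) s - s = -(2 * s) := by
    rw [h]; ring
  rw [hid, Valuation.map_neg, map_mul, h2, hs, one_mul] at h3
  exact lt_irrefl _ h3

end SepClosure

/-! ### Decomposition elements for independent unit square classes -/

section Unramified

variable {K Ω : Type*} [Field K] [Field Ω] [Algebra K Ω]

/-- Cancellation could occur only when `p` and `q` have equal value. Dividing by `q` leaves `z + s`
with `z` in `F`; it is a unit because `(z + s)(z - s) = z² - s²` has value at least `1` and neither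
factor exceeds `1`. -/
lemma valuation_add_mul_eq_max (B : ValuationSubring Ω) (F : IntermediateField K Ω) {s : Ω}
    (hs : B.valuation s = 1) (hns : ∀ z ∈ F, 1 ≤ B.valuation (z ^ 2 - s ^ 2)) {p q : Ω}
    (hp : p ∈ F) (hq : q ∈ F) :
    B.valuation (p + q * s) = max (B.valuation p) (B.valuation q) := by
  by_cases h : B.valuation p = B.valuation (q * s)
  · by_cases hq0 : q = 0
    · simp [hq0]
    have hq' : B.valuation q ≠ 0 := (map_ne_zero _).mpr hq0
    rw [map_mul, hs, mul_one] at h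
    have h1 : B.valuation (p / q) = 1 := by rw [map_div₀, h, div_self hq']
    have h3 : 1 ≤ B.valuation (p / q + s) := by
      by_contra hlt
      rw [not_le] at hlt
      have h4 : B.valuation (p / q - s) ≤ 1 :=
        Valuation.map_sub_le _ h1.le hs.le
      have h5 := hns (p / q) (div_mem hp hq)
      rw [show (p / q) ^ 2 - s ^ 2 = (p / q + s) * (p / q - s) by ring, map_mul] at h5
      exact absurd h5 (not_le.mpr (mul_lt_one_of_lt_of_le hlt h4))
    have h4 : B.valuation (p / q + s) = 1 :=
      le_antisymm (Valuation.map_add_le _ h1.le hs.le) h3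
    rw [h, max_self, show p + q * s = q * (p / q + s) by field_simp, map_mul, h4, mul_one]
  · rw [Valuation.map_add_of_distinct_val _ h, map_mul, hs, mul_one]

/-- If the units `s²` and `t²` are independent modulo squares in the residue field, the
decomposition group contains an element with `s ↦ -s` and `t ↦ t`. -/
lemma exists_decomposition_apply [IsGalois K Ω] (B : ValuationSubring Ω)
    (h2 : B.valuation (2 : Ω) = 1) {s t : Ω} (hs : B.valuation s = 1) (ht : B.valuation t = 1)
    {u v : K} (hu : s ^ 2 = algebraMap K Ω u) (hv : t ^ 2 = algebraMap K Ω v)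
    (hnu : ∀ z : K, 1 ≤ B.valuation (algebraMap K Ω (z ^ 2 - u)))
    (hnv : ∀ z : K, 1 ≤ B.valuation (algebraMap K Ω (z ^ 2 - v)))
    (hnuv : ∀ z : K, 1 ≤ B.valuation (algebraMap K Ω (z ^ 2 - u * v))) :
    ∃ σ ∈ B.decompositionSubgroup K, σ s = -s ∧ σ t = t := by
  have h20 : (2 : Ω) ≠ 0 := fun h => by rw [h, map_zero] at h2; exact zero_ne_one h2
  have hs0 : s ≠ 0 := by rintro rfl; rw [map_zero] at hs; exact zero_ne_one hs
  have ht0 : t ≠ 0 := by rintro rfl; rw [map_zero] at ht; exact zero_ne_one ht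
  have hspm : ∀ g : Ω ≃ₐ[K] Ω, g s = s ∨ g s = -s := fun g => apply_eq_or_eq_neg (by
    rw [hu, AlgEquiv.commutes])
  have htpm : ∀ g : Ω ≃ₐ[K] Ω, g t = t ∨ g t = -t := fun g => apply_eq_or_eq_neg (by
    rw [hv, AlgEquiv.commutes])
  set G := MulAction.stabilizer (Ω ≃ₐ[K] Ω) t
  have hbot : ∀ p q : K, B.valuation (algebraMap K Ω p + algebraMap K Ω q * t) =
      max (B.valuation (algebraMap K Ω p)) (B.valuation (algebraMap K Ω q)) := by
    intro p q
    refine valuation_add_mul_eq_max B ⊥ ht ?_ ⟨p, rfl⟩ ⟨q, rfl⟩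
    rintro _ ⟨z, rfl⟩
    have := hnv z
    rw [map_sub, map_pow, ← hv] at this
    exact this
  have hquad : ∀ x : Ω, (∀ h ∈ G, h x = x) →
      ∃ a b : K, x = algebraMap K Ω a + algebraMap K Ω b * t := by
    intro x hx
    obtain ⟨τ₀, hτ₀⟩ : ∃ τ : Ω ≃ₐ[K] Ω, τ t = -t := by
      by_contra hcon
      push Not at hcon
      obtain ⟨a, ha⟩ := mem_range_of_fixed fun g => (htpm g).resolve_right (hcon g)
      have := hnv a
      rw [map_sub, map_pow, ← hv, ha, sub_self, map_zero] at this
      exact absurd this (by simp)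
    obtain ⟨a, b, ha, hb, hab⟩ := exists_eq_add_mul_of_fixed h20 ⊤ ht0 (fun g _ => htpm g)
      (Subgroup.mem_top τ₀) hτ₀ (fun g _ hg => hx g hg)
    obtain ⟨a, rfl⟩ := mem_range_of_fixed fun g => ha g (Subgroup.mem_top g)
    obtain ⟨b, rfl⟩ := mem_range_of_fixed fun g => hb g (Subgroup.mem_top g)
    exact ⟨a, b, hab⟩
  set F := IntermediateField.fixedField G
  have hF : ∀ x, x ∈ F ↔ ∀ g ∈ G, g x = x := fun x => IntermediateField.mem_fixedField_iff _ _
  -- A residue square root of `s²` in `K(t)` has the form `m + n * t`. Separating the two components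
  -- of its square gives `2mn ≡ 0`. Either `m ≡ 0`, and `u * v` is the residue square of `n * v`, or
  -- `n ≡ 0`, and `u` is that of `m`.
  have hns : ∀ z ∈ F, 1 ≤ B.valuation (z ^ 2 - s ^ 2) := by
    intro z hz
    obtain ⟨m, n, rfl⟩ := hquad z ((hF z).mp hz)
    by_contra hlt
    rw [not_le] at hlt
    have hz1 : B.valuation (algebraMap K Ω m + algebraMap K Ω n * t) ≤ 1 := by
      by_contra h
      rw [not_le] at h
      have h1 : 1 < B.valuation ((algebraMap K Ω m + algebraMap K Ω n * t) ^ 2) := by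
        rw [map_pow]; exact one_lt_pow₀ h two_ne_zero
      have h3 : B.valuation (s ^ 2) = 1 := by rw [map_pow, hs, one_pow]
      rw [Valuation.map_sub_eq_of_lt_left _ (by rw [h3]; exact h1)] at hlt
      exact absurd h1 (not_lt.mpr hlt.le)
    rw [hbot, max_le_iff] at hz1
    have hid : (algebraMap K Ω m + algebraMap K Ω n * t) ^ 2 - s ^ 2 =
        algebraMap K Ω (m ^ 2 + n ^ 2 * v - u) + algebraMap K Ω (2 * m * n) * t := by
      simp only [map_sub, map_add, map_mul, map_pow, ← hu, ← hv, map_ofNat]; ring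
    rw [hid, hbot, max_lt_iff] at hlt
    obtain ⟨hl1, hl2⟩ := hlt
    have hv1 : B.valuation (algebraMap K Ω v) = 1 := by rw [← hv, map_pow, ht, one_pow]
    rw [map_mul, map_mul, map_mul, map_mul, map_ofNat, h2, one_mul] at hl2
    by_cases hm : B.valuation (algebraMap K Ω m) < 1
    · refine absurd (hnuv (n * v)) (not_le.mpr ?_)
      have : (n * v) ^ 2 - u * v = v * ((m ^ 2 + n ^ 2 * v - u) - m ^ 2) := by ring
      rw [this, map_mul, map_mul, hv1, one_mul, map_sub]
      refine Valuation.map_sub_lt _ hl1 ?_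
      rw [map_pow, map_pow]
      exact pow_lt_one₀ zero_le hm two_ne_zero
    · have hm1 := le_antisymm hz1.1 (not_lt.mp hm)
      rw [hm1, one_mul] at hl2
      refine absurd (hnu m) (not_le.mpr ?_)
      have : m ^ 2 - u = (m ^ 2 + n ^ 2 * v - u) - n ^ 2 * v := by ring
      rw [this, map_sub]
      refine Valuation.map_sub_lt _ hl1 ?_
      rw [map_mul, map_mul, hv1, mul_one, map_pow, map_pow]
      exact pow_lt_one₀ zero_le hl2 two_ne_zero
  have hmax : ∀ p ∈ F, ∀ q ∈ F, B.valuation (p + q * s) =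
      max (B.valuation p) (B.valuation q) := fun p hp q hq =>
    valuation_add_mul_eq_max B F hs hns hp hq
  obtain ⟨τ, hτG, hτs⟩ : ∃ τ ∈ G, τ s = -s := by
    by_contra hcon
    push Not at hcon
    have := hns s ((hF s).mpr fun g hg => (hspm g).resolve_right (hcon g hg))
    rw [sub_self, map_zero] at this
    exact absurd this (by simp)
  -- By `hmax`, the trace of `B` on the field generated by `s` over `F` is stable under `s ↦ -s`.
  -- Hence `τ` can be corrected by an element fixing both `s` and `t` so as to preserve `B`.
  obtain ⟨h, hh, hhB⟩ := exists_conj_of_fixed_mem_iff (B.comap (τ : Ω →+* Ω)) B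
    (B.comap (algebraMap K Ω)) (by
      ext x
      change τ (algebraMap K Ω x) ∈ B ↔ algebraMap K Ω x ∈ B
      rw [AlgEquiv.commutes]) rfl (G ⊓ MulAction.stabilizer (Ω ≃ₐ[K] Ω) s)
      ((isClosed_stabilizer t).inter (isClosed_stabilizer s)) (by
      intro x hx
      obtain ⟨a, b, ha, hb, rfl⟩ := exists_eq_add_mul_of_fixed h20 G hs0 (fun g _ => hspm g)
        hτG hτs (fun g hgG hg => hx g ⟨hgG, hg⟩)
      change τ _ ∈ B ↔ _
      rw [map_add, map_mul, hτs, ha τ hτG, hb τ hτG, mul_neg, ← neg_mul,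
        ← B.valuation_le_one_iff, ← B.valuation_le_one_iff,
        hmax a ((hF a).mpr ha) b ((hF b).mpr hb),
        hmax a ((hF a).mpr ha) (-b) (neg_mem ((hF b).mpr hb)), Valuation.map_neg])
  have hhB' : ∀ x, τ x ∈ B ↔ h x ∈ B := hhB
  have hτe : ∀ y, τ (τ⁻¹ y) = y := τ.apply_symm_apply
  have hτe' : ∀ y, τ⁻¹ (τ y) = y := τ.symm_apply_apply
  refine ⟨h * τ⁻¹, (mem_decompositionSubgroup_iff B _).mpr fun x => ?_, ?_, ?_⟩
  · rw [AlgEquiv.mul_apply, ← hhB', hτe]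
  · rw [AlgEquiv.mul_apply, inv_apply_eq_neg hτs, map_neg]
    exact congrArg _ hh.2
  · have h1 : τ⁻¹ t = t := by
      have : τ t = t := hτG
      conv_lhs => rw [← this]
      exact hτe' t
    rw [AlgEquiv.mul_apply, h1]
    exact hh.1

end Unramified

/-! ### Joint eigenvectors of the quaternion generators -/

section Eigenvectors

variable {L V : Type*} [Field L] [AddCommGroup V] [Module L V]

/-- Since `(J - β)(J + β) = 0`, the vector `J x + β x` works unless it vanishes; then `x` has
eigenvalue `-β`, and `I` reverses the sign. The explicit form of `a` is recorded so that an
eigenvalue for an operator commuting with `I` and `J` passes from `x` to `a`. -/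
lemma exists_eigenvector_of_anticommute {I J : V →ₗ[L] V} {r β : L} (hr : r ≠ 0)
    (hI : ∀ x, I (I x) = r • x) (hJ : ∀ x, J (J x) = β ^ 2 • x) (hIJ : ∀ x, I (J x) = -J (I x))
    {x : V} (hx : x ≠ 0) : ∃ a ≠ 0, J a = β • a ∧ (a = J x + β • x ∨ a = I x) := by
  by_cases h : J x + β • x = 0
  · refine ⟨I x, fun h0 => hx ?_, ?_, Or.inr rfl⟩
    · have := hI x
      rw [h0, map_zero] at this
      exact (smul_eq_zero.mp this.symm).resolve_left hr
    · rw [← neg_neg (J (I x)), ← hIJ, eq_neg_of_add_eq_zero_left h, map_neg, map_smul, neg_neg]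
  · refine ⟨_, h, ?_, Or.inl rfl⟩
    rw [map_add, map_smul, hJ, smul_add, smul_smul, sq, add_comm]

variable {I₁ J₁ I₂ J₂ : V →ₗ[L] V} {r s β γ : L} {v : V}

/-- The left sides are the products `(1 ± β⁻¹ J₁)(1 ± γ⁻¹ J₂)` applied to `w`, four times the
projections to the joint eigenspaces. The vectors `v`, `I₁ v`, `I₂ v`, `I₁ I₂ v` carry the four sign
pairs of eigenvalues `±β`, `±γ`. -/
lemma smul_eigen_combination (hβ : β ≠ 0) (hγ : γ ≠ 0)
    (hIJ₁ : ∀ x, I₁ (J₁ x) = -J₁ (I₁ x)) (hIJ₂ : ∀ x, I₂ (J₂ x) = -J₂ (I₂ x))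
    (hJI : ∀ x, J₁ (I₂ x) = I₂ (J₁ x)) (hIJ : ∀ x, J₂ (I₁ x) = I₁ (J₂ x))
    (hv₁ : J₁ v = β • v) (hv₂ : J₂ v = γ • v) {c₀ c₁ c₂ c₃ : L} {w : V}
    (hw : w = c₀ • v + c₁ • I₁ v + c₂ • I₂ v + c₃ • I₁ (I₂ v)) :
    w + β⁻¹ • J₁ w + γ⁻¹ • J₂ w + β⁻¹ • γ⁻¹ • J₁ (J₂ w) = (4 * c₀) • v ∧
    w - β⁻¹ • J₁ w + γ⁻¹ • J₂ w - β⁻¹ • γ⁻¹ • J₁ (J₂ w) = (4 * c₁) • I₁ v ∧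
    w + β⁻¹ • J₁ w - γ⁻¹ • J₂ w - β⁻¹ • γ⁻¹ • J₁ (J₂ w) = (4 * c₂) • I₂ v ∧
    w - β⁻¹ • J₁ w - γ⁻¹ • J₂ w + β⁻¹ • γ⁻¹ • J₁ (J₂ w) = (4 * c₃) • I₁ (I₂ v) := by
  have h1 : ∀ x, J₁ (I₁ x) = -I₁ (J₁ x) := fun x => by rw [hIJ₁, neg_neg]
  have h3 : ∀ x, J₂ (I₂ x) = -I₂ (J₂ x) := fun x => by rw [hIJ₂, neg_neg]
  have e1 : β⁻¹ • J₁ w = c₀ • v - c₁ • I₁ v + c₂ • I₂ v - c₃ • I₁ (I₂ v) := by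
    rw [hw]
    simp only [map_add, map_smul, h1, hJI, hv₁, smul_neg]
    match_scalars <;> field_simp
  have e2 : γ⁻¹ • J₂ w = c₀ • v + c₁ • I₁ v - c₂ • I₂ v - c₃ • I₁ (I₂ v) := by
    rw [hw]
    simp only [map_add, map_smul, h3, hIJ, hv₂, smul_neg, map_neg]
    match_scalars <;> field_simp
  have e3 : β⁻¹ • γ⁻¹ • J₁ (J₂ w) = c₀ • v - c₁ • I₁ v - c₂ • I₂ v + c₃ • I₁ (I₂ v) := by
    rw [hw]
    simp only [map_add, map_smul, h1, hJI, h3, hIJ, hv₁, hv₂, smul_neg, map_neg]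
    match_scalars <;> field_simp
  rw [e1, e2, e3, hw]
  refine ⟨?_, ?_, ?_, ?_⟩ <;> match_scalars <;> ring

lemma linearIndependent_eigenvectors (h2 : (2 : L) ≠ 0) (hβ : β ≠ 0) (hγ : γ ≠ 0)
    (hr : r ≠ 0) (hs : s ≠ 0) (hI₁ : ∀ x, I₁ (I₁ x) = r • x) (hI₂ : ∀ x, I₂ (I₂ x) = s • x)
    (hIJ₁ : ∀ x, I₁ (J₁ x) = -J₁ (I₁ x)) (hIJ₂ : ∀ x, I₂ (J₂ x) = -J₂ (I₂ x))
    (hJI : ∀ x, J₁ (I₂ x) = I₂ (J₁ x)) (hIJ : ∀ x, J₂ (I₁ x) = I₁ (J₂ x))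
    (hv : v ≠ 0) (hv₁ : J₁ v = β • v) (hv₂ : J₂ v = γ • v) :
    LinearIndependent L ![v, I₁ v, I₂ v, I₁ (I₂ v)] := by
  have hi₁ : ∀ x, x ≠ 0 → I₁ x ≠ 0 := fun x hx h0 => by
    have := hI₁ x
    rw [h0, map_zero] at this
    exact hx ((smul_eq_zero.mp this.symm).resolve_left hr)
  have hi₂ : ∀ x, x ≠ 0 → I₂ x ≠ 0 := fun x hx h0 => by
    have := hI₂ x
    rw [h0, map_zero] at this
    exact hx ((smul_eq_zero.mp this.symm).resolve_left hs)
  have h4 : (4 : L) ≠ 0 := by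
    rw [show (4 : L) = 2 * 2 by norm_num]; exact mul_ne_zero h2 h2
  rw [Fintype.linearIndependent_iff]
  intro c hc
  simp only [Fin.sum_univ_four, Matrix.cons_val] at hc
  obtain ⟨k0, k1, k2, k3⟩ := smul_eigen_combination hβ hγ hIJ₁ hIJ₂ hJI hIJ hv₁ hv₂ hc.symm
  simp only [map_zero, smul_zero, add_zero, sub_zero] at k0 k1 k2 k3
  have fin : ∀ {d : L} {y : V}, y ≠ 0 → 0 = (4 * d) • y → d = 0 := fun hy h =>
    (mul_eq_zero.mp ((smul_eq_zero.mp h.symm).resolve_right hy)).resolve_left h4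
  intro i
  fin_cases i
  · exact fin hv k0
  · exact fin (hi₁ _ hv) k1
  · exact fin (hi₂ _ hv) k2
  · exact fin (hi₁ _ (hi₂ _ hv)) k3

end Eigenvectors

/-! ### The determinant of the descent datum -/

section Determinant

variable {L : Type*} [Field L]

/-- The determinant of a semilinear descent datum on the split biquaternion algebra that changes
the sign of `β`. -/
theorem exists_det_mul_map_det_eq (h2 : (2 : L) ≠ 0) (φ : L →+* L) {r s β γ : L} (hβ : β ≠ 0)
    (hγ : γ ≠ 0) (hr : r ≠ 0) (hs : s ≠ 0) (hφβ : φ β = -β) (hφγ : φ γ = γ)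
    {I₁ J₁ I₂ J₂ g : Matrix (Fin 4) (Fin 4) L}
    (hI₁ : I₁ * I₁ = Matrix.scalar _ r) (hI₂ : I₂ * I₂ = Matrix.scalar _ s)
    (hJ₁ : J₁ * J₁ = Matrix.scalar _ (β ^ 2)) (hJ₂ : J₂ * J₂ = Matrix.scalar _ (γ ^ 2))
    (hIJ₁ : I₁ * J₁ = -(J₁ * I₁)) (hIJ₂ : I₂ * J₂ = -(J₂ * I₂))
    (hI : I₁ * I₂ = I₂ * I₁) (hJ : J₁ * J₂ = J₂ * J₁)
    (hJI : J₁ * I₂ = I₂ * J₁) (hIJ : J₂ * I₁ = I₁ * J₂)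
    (gI₁ : g * I₁.map φ = I₁ * g) (gI₂ : g * I₂.map φ = I₂ * g)
    (gJ₁ : g * J₁.map φ = J₁ * g) (gJ₂ : g * J₂.map φ = J₂ * g) :
    ∃ l d : L, d ≠ 0 ∧ g.det * φ d = l ^ 4 * r ^ 2 * d := by
  have op : ∀ {X Y Z : Matrix (Fin 4) (Fin 4) L}, X * Y = Z → ∀ x,
      X.mulVecLin (Y.mulVecLin x) = Z.mulVecLin x := by
    rintro X Y _ rfl x
    simp only [Matrix.mulVecLin_apply, Matrix.mulVec_mulVec]
  have opsc : ∀ {X Y : Matrix (Fin 4) (Fin 4) L} {c : L}, X * Y = Matrix.scalar _ c → ∀ x,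
      X.mulVecLin (Y.mulVecLin x) = c • x := by
    intro X Y c h x
    rw [op h, Matrix.mulVecLin_apply, Matrix.scalar_apply, ← Matrix.smul_one_eq_diagonal,
      Matrix.smul_mulVec, Matrix.one_mulVec]
  have opneg : ∀ {X Y : Matrix (Fin 4) (Fin 4) L}, X * Y = -(Y * X) → ∀ x,
      X.mulVecLin (Y.mulVecLin x) = -Y.mulVecLin (X.mulVecLin x) := by
    intro X Y h x
    rw [op h, op (rfl : Y * X = Y * X), Matrix.mulVecLin_apply, Matrix.mulVecLin_apply,
      Matrix.neg_mulVec]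
  have opcomm : ∀ {X Y : Matrix (Fin 4) (Fin 4) L}, X * Y = Y * X → ∀ x,
      X.mulVecLin (Y.mulVecLin x) = Y.mulVecLin (X.mulVecLin x) := fun h x => by
    rw [op h, op rfl]
  -- The `φ`-semilinear operator attached to `g`; the hypotheses on `g` say that it commutes with
  -- the four generators.
  let Φ : (Fin 4 → L) → (Fin 4 → L) := fun x => g.mulVec (φ ∘ x)
  have Φop : ∀ {X : Matrix (Fin 4) (Fin 4) L}, g * X.map φ = X * g → ∀ x,
      Φ (X.mulVecLin x) = X.mulVecLin (Φ x) := by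
    intro X h x
    have : φ ∘ (X.mulVec x) = (X.map φ).mulVec (φ ∘ x) := by
      ext i; exact RingHom.map_mulVec φ X x i
    simp only [Φ, Matrix.mulVecLin_apply, this, Matrix.mulVec_mulVec, h]
  have Φsmul : ∀ (c : L) (x), Φ (c • x) = φ c • Φ x := by
    intro c x
    have : φ ∘ (c • x) = φ c • (φ ∘ x) := by
      ext i; simp
    simp only [Φ, this, Matrix.mulVec_smul]
  obtain ⟨a, ha0, ha, -⟩ := exists_eigenvector_of_anticommute hs (opsc hI₂) (opsc hJ₂) (opneg hIJ₂)
    (x := Pi.single 0 1) (by simp)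
  obtain ⟨v, hv0, hv₁, hv⟩ := exists_eigenvector_of_anticommute hr (opsc hI₁) (opsc hJ₁)
    (opneg hIJ₁) ha0
  have hv₂ : J₂.mulVecLin v = γ • v := by
    rcases hv with rfl | rfl
    · rw [map_add, map_smul, ← opcomm hJ, ha, map_smul, smul_add, smul_comm β γ]
    · rw [opcomm hIJ, ha, map_smul]
  have hli := linearIndependent_eigenvectors h2 hβ hγ hr hs (opsc hI₁) (opsc hI₂) (opneg hIJ₁)
    (opneg hIJ₂) (opcomm hJI) (opcomm hIJ) hv0 hv₁ hv₂
  set q : Fin 4 → Fin 4 → L := ![v, I₁.mulVecLin v, I₂.mulVecLin v,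
    I₁.mulVecLin (I₂.mulVecLin v)] with hq
  -- As `φ` negates `β`, `Φ v` has eigenvalues `-β`, `γ`; applying `I₁` restores `β`, `γ`. The joint
  -- eigenspace is the line through `v`, so `Φ v` is a multiple of `I₁ v`.
  let w := I₁.mulVecLin (Φ v)
  have hw₁ : J₁.mulVecLin w = β • w := by
    have h1 := opneg hIJ₁ (Φ v)
    rw [← Φop gJ₁, hv₁, Φsmul, hφβ, map_smul, neg_smul] at h1
    exact (neg_injective h1).symm
  have hw₂ : J₂.mulVecLin w = γ • w := by
    change J₂.mulVecLin (I₁.mulVecLin _) = _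
    rw [opcomm hIJ, ← Φop gJ₂, hv₂, Φsmul, hφγ, map_smul]
  have hspan : w ∈ Submodule.span L (Set.range q) := by
    rw [hli.span_eq_top_of_card_eq_finrank (by simp)]
    trivial
  obtain ⟨c, hc⟩ := (Submodule.mem_span_range_iff_exists_fun L).mp hspan
  simp only [Fin.sum_univ_four, hq, Matrix.cons_val] at hc
  have h0 := (smul_eigen_combination hβ hγ (opneg hIJ₁)
    (opneg hIJ₂) (opcomm hJI) (opcomm hIJ) hv₁ hv₂ hc.symm).1
  have hwv : w = c 0 • v := by
    rw [hw₂, map_smul, hw₁] at h0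
    have h4 : (4 : L) ≠ 0 := by
      rw [show (4 : L) = 2 * 2 by norm_num]; exact mul_ne_zero h2 h2
    have h5 : w + β⁻¹ • β • w + γ⁻¹ • γ • w + β⁻¹ • γ⁻¹ • γ • β • w = (4 : L) • w := by
      match_scalars; field_simp; norm_num
    rw [h5, mul_smul] at h0
    exact smul_right_injective _ h4 h0
  set l := r⁻¹ * c 0 with hl
  have hz : Φ v = l • I₁.mulVecLin v := by
    have h1 := opsc hI₁ (Φ v)
    change I₁.mulVecLin w = _ at h1
    rw [hwv, map_smul] at h1
    rw [hl, mul_smul, h1, smul_smul, inv_mul_cancel₀ hr, one_smul]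
  let P : Matrix (Fin 4) (Fin 4) L := Matrix.of fun i j => q j i
  -- Up to the scalar `l`, the matrix of `Φ` in the basis `q`: it is that of `I₁`, two blocks of
  -- determinant `-r`.
  let M : Matrix (Fin 4) (Fin 4) L := !![0, r, 0, 0; 1, 0, 0, 0; 0, 0, 0, r; 0, 0, 1, 0]
  have hcol : ∀ j, Φ (q j) = fun i => (P * (l • M)) i j := by
    have e0 : Φ (q 0) = l • q 1 := hz
    have e1 : Φ (q 1) = (l * r) • q 0 := by
      change Φ (I₁.mulVecLin v) = (l * r) • v
      rw [Φop gI₁, hz, map_smul, opsc hI₁, smul_smul]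
    have e2 : Φ (q 2) = l • q 3 := by
      change Φ (I₂.mulVecLin v) = l • I₁.mulVecLin (I₂.mulVecLin v)
      rw [Φop gI₂, hz, map_smul, opcomm hI]
    have e3 : Φ (q 3) = (l * r) • q 2 := by
      change Φ (I₁.mulVecLin (I₂.mulVecLin v)) = (l * r) • I₂.mulVecLin v
      rw [Φop gI₁, Φop gI₂, hz, map_smul, map_smul, opcomm hI, opsc hI₁, map_smul, smul_smul]
    intro j
    funext i
    fin_cases j
    · simpa [Matrix.mul_apply, Fin.sum_univ_four, M, P, mul_comm] using congrFun e0 i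
    · simpa [Matrix.mul_apply, Fin.sum_univ_four, M, P, mul_comm] using congrFun e1 i
    · simpa [Matrix.mul_apply, Fin.sum_univ_four, M, P, mul_comm] using congrFun e2 i
    · simpa [Matrix.mul_apply, Fin.sum_univ_four, M, P, mul_comm] using congrFun e3 i
  have hmat : g * P.map φ = P * (l • M) := by
    ext i j
    rw [← congrFun (hcol j) i]
    simp [Matrix.mul_apply, Φ, Matrix.mulVec, dotProduct, P]
  have hM : M.det = r ^ 2 := by
    simp [M, Matrix.det_succ_row_zero, Fin.sum_univ_succ, Fin.succAbove]
    ring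
  refine ⟨l, P.det, ?_, ?_⟩
  · have : IsUnit P.transpose := Matrix.linearIndependent_rows_iff_isUnit.mp hli
    rw [Matrix.isUnit_iff_isUnit_det, Matrix.det_transpose] at this
    exact this.ne_zero
  · have := congrArg Matrix.det hmat
    rw [Matrix.det_mul, Matrix.det_mul, Matrix.det_smul, hM] at this
    rw [RingHom.map_det]
    change g.det * (P.map φ).det = _
    rw [this]
    simp
    ring

end Determinant

/-! ### From a trivial residue to even values -/

section Residue

variable {K : Type*} [Field K]

/-- `B.valuation` has its own value group, so it can be compared with `w` only up to equivalence;
values of elements of `K` are transferred through this. -/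
lemma isEquiv_comap_valuation {Ω : Type*} [Field Ω] [Algebra K Ω] {w : Valuation K ℤᵐ⁰}
    {B : ValuationSubring Ω} (hB : B.comap (algebraMap K Ω) = w.valuationSubring) :
    (B.valuation.comap (algebraMap K Ω)).IsEquiv w := by
  rw [Valuation.isEquiv_iff_valuationSubring, ← hB]
  ext x
  exact B.valuation_le_one_iff _

lemma valuation_eq_one_of_sq {Ω : Type*} [Field Ω] [Algebra K Ω] {w : Valuation K ℤᵐ⁰}
    {B : ValuationSubring Ω} (hB : B.comap (algebraMap K Ω) = w.valuationSubring) {x : Ω} {a : K}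
    (ha : w a = 1) (hx : x ^ 2 = algebraMap K Ω a) : B.valuation x = 1 := by
  have h : B.valuation (algebraMap K Ω a) = 1 :=
    (isEquiv_comap_valuation hB).eq_one_iff_eq_one.mpr ha
  rw [← hx, map_pow] at h
  exact (pow_left_inj₀ zero_le zero_le two_ne_zero).mp (by rw [h, one_pow])

lemma even_ord_of_sq_eq {w : Valuation K ℤᵐ⁰} {a r : K} (hr : r ≠ 0) (h : w a ^ 2 = w r) :
    Even (ord w r) := by
  refine ⟨ord w a, ?_⟩
  have ha : w a ≠ 0 := by
    intro h0
    rw [h0, zero_pow two_ne_zero] at h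
    exact (map_ne_zero w).mpr hr h.symm
  rw [ord, ord, ← h, WithZero.log_pow]
  simp; ring

/-- `exists_det_mul_map_det_eq` for the image of a product of two quaternion algebras under a
representation. -/
lemma exists_det_mul_map_det_eq_of_algHom {A L : Type*} [Ring A] [Algebra K A] [Field L]
    [Algebra K L] (h2 : (2 : L) ≠ 0) (φ : L →+* L) (E : A →ₐ[K] Matrix (Fin 4) (Fin 4) L)
    (g : Matrix (Fin 4) (Fin 4) L) (hgE : ∀ x : A, g * (E x).map φ = E x * g) {r u s t : K}
    (hr : r ≠ 0) (hs : s ≠ 0) {b c : L} (hb : b ≠ 0) (hc : c ≠ 0) (hb2 : b ^ 2 = algebraMap K L u)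
    (hc2 : c ^ 2 = algebraMap K L t) (hφb : φ b = -b) (hφc : φ c = c) {i₁ j₁ i₂ j₂ : A}
    (hi₁ : i₁ * i₁ = algebraMap K A r) (hi₂ : i₂ * i₂ = algebraMap K A s)
    (hj₁ : j₁ * j₁ = algebraMap K A u) (hj₂ : j₂ * j₂ = algebraMap K A t)
    (hij₁ : i₁ * j₁ = -(j₁ * i₁)) (hij₂ : i₂ * j₂ = -(j₂ * i₂)) (hi : i₁ * i₂ = i₂ * i₁)
    (hj : j₁ * j₂ = j₂ * j₁) (hji : j₁ * i₂ = i₂ * j₁) (hij : j₂ * i₁ = i₁ * j₂) :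
    ∃ l d : L, d ≠ 0 ∧ g.det * φ d = l ^ 4 * algebraMap K L r ^ 2 * d := by
  have hE : ∀ x y : A, x * y = -(y * x) → E x * E y = -(E y * E x) := fun x y h => by
    rw [← map_mul, h, map_neg, map_mul]
  have hE' : ∀ x y : A, x * y = y * x → E x * E y = E y * E x := fun x y h => by
    rw [← map_mul, h, map_mul]
  have hEs : ∀ (x : A) (a : K), x * x = algebraMap K A a →
      E x * E x = Matrix.scalar (Fin 4) (algebraMap K L a) := fun x a h => by
    rw [← map_mul, h, AlgHom.commutes]; rfl
  exact exists_det_mul_map_det_eq h2 φ hb hc (by simpa using hr)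
    (by simpa using hs : algebraMap K L s ≠ 0) hφb hφc
    (hEs i₁ r hi₁) (hEs i₂ s hi₂) (by rw [hb2]; exact hEs j₁ u hj₁)
    (by rw [hc2]; exact hEs j₂ t hj₂)
    (hE _ _ hij₁) (hE _ _ hij₂) (hE' _ _ hi) (hE' _ _ hj) (hE' _ _ hji) (hE' _ _ hij)
    (hgE i₁) (hgE i₂) (hgE j₁) (hgE j₂)

set_option maxHeartbeats 1000000 in
/-- The value of the descent datum at an element of the decomposition group changing the sign of a
square root of the second entry of the first symbol only. -/
theorem exists_valuation_eq_of_isResidue_zero {A : Type*} [Ring A] [Algebra K A]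
    (hA : Module.finrank K A = 16) (w : Valuation K ℤᵐ⁰)
    (B : ValuationSubring (SeparableClosure K))
    (hB : B.comap (algebraMap K (SeparableClosure K)) = w.valuationSubring) (h2 : w 2 = 1)
    (hres : IsResidue w B A 0) {r u s t : K} (hr : r ≠ 0) (hs : s ≠ 0) (hu : w u = 1) (ht : w t = 1)
    {β γ : SeparableClosure K} (hβ : β ^ 2 = algebraMap K _ u) (hγ : γ ^ 2 = algebraMap K _ t)
    {σ : SeparableClosure K ≃ₐ[K] SeparableClosure K} (hσ : σ ∈ B.decompositionSubgroup K)
    (hσβ : σ β = -β) (hσγ : σ γ = γ) {i₁ j₁ i₂ j₂ : A}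
    (hi₁ : i₁ * i₁ = algebraMap K A r) (hi₂ : i₂ * i₂ = algebraMap K A s)
    (hj₁ : j₁ * j₁ = algebraMap K A u) (hj₂ : j₂ * j₂ = algebraMap K A t)
    (hij₁ : i₁ * j₁ = -(j₁ * i₁)) (hij₂ : i₂ * j₂ = -(j₂ * i₂)) (hi : i₁ * i₂ = i₂ * i₁)
    (hj : j₁ * j₂ = j₂ * j₁) (hji : j₁ * i₂ = i₂ * j₁) (hij : j₂ * i₁ = i₁ * j₂) :
    ∃ (d : K) (l : maxUnramified B) (m : ℤ), d ≠ 0 ∧ l ≠ 0 ∧ ord w d = 4 * m ∧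
      B.valuation (algebraMap K _ d) =
        B.valuation (l : SeparableClosure K) ^ 4 * B.valuation (algebraMap K _ r) ^ 2 := by
  obtain ⟨n, e, he⟩ := hres
  -- Comparing dimensions over the unramified extension gives `n² = 16`.
  obtain rfl : n = 4 := by
    have h1 := e.toLinearEquiv.finrank_eq
    rw [Module.finrank_baseChange, hA, Module.finrank_matrix, Module.finrank_self] at h1
    simp only [Fintype.card_fin, mul_one] at h1
    nlinarith
  have heq := isEquiv_comap_valuation hB
  have hone : ∀ x : K, w x = 1 → B.valuation (algebraMap K _ x) = 1 := fun x hx =>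
    heq.eq_one_iff_eq_one.mpr hx
  have h2B : B.valuation (2 : SeparableClosure K) = 1 := by
    rw [← map_ofNat (algebraMap K (SeparableClosure K)) 2]; exact hone 2 h2
  have hβ1 := valuation_eq_one_of_sq hB hu hβ
  have hγ1 := valuation_eq_one_of_sq hB ht hγ
  set L := maxUnramified B
  let b : L := ⟨β, mem_maxUnramified_of_sq B h2B hβ1 hβ⟩
  let c : L := ⟨γ, mem_maxUnramified_of_sq B h2B hγ1 hγ⟩
  obtain ⟨g, d, hg, hd, hχ⟩ := he ⟨σ, hσ⟩
  set φ : L →+* L := (decompositionAct B ⟨σ, hσ⟩ : L →+* L) with hφ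
  let E : A →ₐ[K] Matrix (Fin 4) (Fin 4) L :=
    (e.toAlgHom.restrictScalars K).comp Algebra.TensorProduct.includeRight
  have hgE : ∀ x : A, (g : Matrix (Fin 4) (Fin 4) L) * (E x).map φ = E x * g := by
    intro x
    have h1 : E x = g * (E x).map φ * ((g⁻¹ : GL (Fin 4) L) : Matrix (Fin 4) (Fin 4) L) := hg x
    conv_rhs => rw [h1]
    rw [mul_assoc, Units.inv_mul, mul_one]
  have nz : ∀ x : L, B.valuation (x : SeparableClosure K) = 1 → x ≠ 0 := by
    rintro x hx rfl
    rw [ZeroMemClass.coe_zero, map_zero] at hx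
    exact zero_ne_one hx
  obtain ⟨l, p, hp, hdet⟩ := exists_det_mul_map_det_eq_of_algHom (nz 2 h2B) φ E g hgE hr hs
    (nz b hβ1) (nz c hγ1) (Subtype.ext hβ : b ^ 2 = algebraMap K L u)
    (Subtype.ext hγ : c ^ 2 = algebraMap K L t) (Subtype.ext hσβ) (Subtype.ext hσγ)
    hi₁ hi₂ hj₁ hj₂ hij₁ hij₂ hi hj hji hij
  -- The coboundary factor `φ p / p` has value one, so only `l ^ 4 * r ^ 2` contributes.
  have hφp : B.valuation ((φ p : L) : SeparableClosure K) =
      B.valuation (p : SeparableClosure K) :=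
    valuation_apply_of_decomposition B ((mem_decompositionSubgroup_iff B σ).mp hσ) _
  have hp' : B.valuation (p : SeparableClosure K) ≠ 0 :=
    (map_ne_zero _).mpr (by simpa using hp)
  have hval : B.valuation (algebraMap K _ d) =
      B.valuation (l : SeparableClosure K) ^ 4 * B.valuation (algebraMap K _ r) ^ 2 := by
    have h1 := congrArg (fun x : L => B.valuation (x : SeparableClosure K)) hdet
    simp only [MulMemClass.coe_mul, SubmonoidClass.coe_pow, map_mul, map_pow, hφp] at h1
    rw [hd]
    exact mul_right_cancel₀ hp' h1
  have hd0 : d ≠ 0 := by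
    rintro rfl
    rw [map_zero, map_zero] at hd
    have h1 : (g : Matrix (Fin 4) (Fin 4) L).det ≠ 0 :=
      ((Matrix.isUnit_iff_isUnit_det _).mp g.isUnit).ne_zero
    exact (map_ne_zero B.valuation).mpr (by simpa using h1) hd.symm
  have hl0 : l ≠ 0 := by
    rintro rfl
    rw [ZeroMemClass.coe_zero, map_zero, zero_pow four_ne_zero, zero_mul] at hval
    exact (map_ne_zero B.valuation).mpr (by simpa using hd0) hval
  obtain ⟨m, hm⟩ : ∃ m : ℤ, ord w d = 4 * m := by
    have h1 : ((((ord w d : ℚ) / ((4 : ℕ) : ℚ) : ℚ)) : AddCircle (1 : ℚ)) = 0 := hχ.symm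
    obtain ⟨m, hm⟩ := (AddCircle.coe_eq_zero_iff (1 : ℚ)).mp h1
    refine ⟨m, ?_⟩
    have h3 : (m : ℚ) = (ord w d : ℚ) / 4 := by simpa using hm
    have h4 : (ord w d : ℚ) = 4 * m := by rw [h3]; ring
    exact_mod_cast h4
  exact ⟨d, l, m, hd0, hl0, hm, hval⟩

/-- If a product of two symbols is unramified and the decomposition group contains an element
changing the sign of a square root of the second entry of the first symbol only, then the first
entry of this symbol has even value. -/
theorem even_ord_of_isResidue_zero {A : Type*} [Ring A] [Algebra K A]
    (hA : Module.finrank K A = 16) (w : Valuation K ℤᵐ⁰) (hϖ : Function.Surjective w)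
    (B : ValuationSubring (SeparableClosure K))
    (hB : B.comap (algebraMap K (SeparableClosure K)) = w.valuationSubring) (h2 : w 2 = 1)
    (hres : IsResidue w B A 0) {r u s t : K} (hr : r ≠ 0) (hs : s ≠ 0) (hu : w u = 1) (ht : w t = 1)
    {β γ : SeparableClosure K} (hβ : β ^ 2 = algebraMap K _ u) (hγ : γ ^ 2 = algebraMap K _ t)
    {σ : SeparableClosure K ≃ₐ[K] SeparableClosure K} (hσ : σ ∈ B.decompositionSubgroup K)
    (hσβ : σ β = -β) (hσγ : σ γ = γ) {i₁ j₁ i₂ j₂ : A}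
    (hi₁ : i₁ * i₁ = algebraMap K A r) (hi₂ : i₂ * i₂ = algebraMap K A s)
    (hj₁ : j₁ * j₁ = algebraMap K A u) (hj₂ : j₂ * j₂ = algebraMap K A t)
    (hij₁ : i₁ * j₁ = -(j₁ * i₁)) (hij₂ : i₂ * j₂ = -(j₂ * i₂)) (hi : i₁ * i₂ = i₂ * i₁)
    (hj : j₁ * j₂ = j₂ * j₁) (hji : j₁ * i₂ = i₂ * j₁) (hij : j₂ * i₁ = i₁ * j₂) :
    Even (ord w r) := by
  have heq := isEquiv_comap_valuation hB
  have h2B : B.valuation (2 : SeparableClosure K) = 1 := by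
    rw [← map_ofNat (algebraMap K (SeparableClosure K)) 2]
    exact heq.eq_one_iff_eq_one.mpr h2
  obtain ⟨d, l, m, hd0, hl, hm, hval⟩ := exists_valuation_eq_of_isResidue_zero hA w B hB h2 hres
    hr hs hu ht hβ hγ hσ hσβ hσγ hi₁ hi₂ hj₁ hj₂ hij₁ hij₂ hi hj hji hij
  have hl0 : B.valuation (l : SeparableClosure K) ≠ 0 :=
    (map_ne_zero _).mpr (by simpa using hl)
  -- The sign is negative because `ord` is minus the logarithm; thus `q` has order `m` and `q ^ 4`
  -- has the value of `d`.
  obtain ⟨q, hq⟩ := hϖ (WithZero.exp (-m))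
  have hdq : w d = w (q ^ 4) := by
    have h1 : w d = WithZero.exp (WithZero.log (w d)) :=
      (WithZero.exp_log ((map_ne_zero w).mpr hd0)).symm
    rw [h1, map_pow, hq, ← WithZero.exp_nsmul]
    congr 1
    rw [ord] at hm
    simp
    linarith
  have hdq' : B.valuation (algebraMap K _ d) = B.valuation (algebraMap K _ q) ^ 4 := by
    rw [← map_pow, ← map_pow]
    exact heq.eq_iff.mpr hdq
  by_contra hodd
  have hπ : ∀ a : K, B.valuation (algebraMap K (SeparableClosure K) a) ^ 2 ≠
      B.valuation (algebraMap K _ r) := by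
    intro a ha
    rw [← map_pow, ← map_pow] at ha
    refine hodd (even_ord_of_sq_eq (a := a) hr ?_)
    rw [← map_pow]
    exact heq.eq_iff.mp ha
  -- From `q⁴` and `l⁴ r²` having equal value, `(q / l)²` has the value of `r`, with `q / l`
  -- unramified.
  refine valuation_sq_ne_of_mem_maxUnramified B h2B hπ
    (div_mem (algebraMap_mem (maxUnramified B) q) l.2) ?_
  rw [hdq'] at hval
  rw [map_div₀, div_pow, div_eq_iff (pow_ne_zero _ hl0)]
  refine (pow_left_inj₀ zero_le zero_le two_ne_zero).mp ?_
  rw [mul_pow, ← pow_mul, ← pow_mul, hval, mul_comm]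

/-- If the units `u`, `t` are independent modulo squares in the residue field of `w` and
`(r, u) ⊗ (s, t)` is unramified at `w`, then `r` and `s` have even value. -/
theorem even_ord_of_isUnramified (w : Valuation K ℤᵐ⁰) (hϖ : Function.Surjective w) (h2 : w 2 = 1)
    {r u s t : K} (hr : r ≠ 0) (hs : s ≠ 0) (hu : w u = 1) (ht : w t = 1)
    (hnu : ∀ z : K, 1 ≤ w (z ^ 2 - u)) (hnt : ∀ z : K, 1 ≤ w (z ^ 2 - t))
    (hnut : ∀ z : K, 1 ≤ w (z ^ 2 - u * t))
    (h : IsUnramified w (ℍ[K, r, u] ⊗[K] ℍ[K, s, t])) :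
    Even (ord w r) ∧ Even (ord w s) := by
  obtain ⟨B, hB, hres⟩ := h
  have heq := isEquiv_comap_valuation hB
  have hone : ∀ x : K, w x = 1 → B.valuation (algebraMap K _ x) = 1 := fun x hx =>
    heq.eq_one_iff_eq_one.mpr hx
  have hle : ∀ x : K, 1 ≤ w x → 1 ≤ B.valuation (algebraMap K _ x) := fun x hx =>
    not_lt.mp fun hlt => not_lt.mpr hx (heq.lt_one_iff_lt_one.mp hlt)
  have h2B : B.valuation (2 : SeparableClosure K) = 1 := by
    rw [← map_ofNat (algebraMap K (SeparableClosure K)) 2]; exact hone 2 h2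
  have : NeZero (2 : SeparableClosure K) := ⟨fun h => by
    rw [h, map_zero] at h2B; exact zero_ne_one h2B⟩
  obtain ⟨β, hβ⟩ := IsSepClosed.exists_pow_nat_eq (algebraMap K (SeparableClosure K) u) 2
  obtain ⟨γ, hγ⟩ := IsSepClosed.exists_pow_nat_eq (algebraMap K (SeparableClosure K) t) 2
  have hβ1 := valuation_eq_one_of_sq hB hu hβ
  have hγ1 := valuation_eq_one_of_sq hB ht hγ
  obtain ⟨σ, hσ, hσβ, hσγ⟩ := exists_decomposition_apply B h2B hβ1 hγ1 hβ hγ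
    (fun z => hle _ (hnu z)) (fun z => hle _ (hnt z)) (fun z => hle _ (hnut z))
  obtain ⟨τ, hτ, hτγ, hτβ⟩ := exists_decomposition_apply B h2B hγ1 hβ1 hγ hβ
    (fun z => hle _ (hnt z)) (fun z => hle _ (hnu z))
    (fun z => hle _ (by rw [mul_comm]; exact hnut z))
  have hfin : Module.finrank K (ℍ[K, r, u] ⊗[K] ℍ[K, s, t]) = 16 := by
    rw [Module.finrank_tensorProduct, QuaternionAlgebra.finrank_eq_four,
      QuaternionAlgebra.finrank_eq_four]
  have qi : ∀ a c : K, (⟨0, 1, 0, 0⟩ : ℍ[K, a, c]) * ⟨0, 1, 0, 0⟩ = algebraMap K _ a := by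
    intro a c; ext <;> simp
  have qj : ∀ a c : K, (⟨0, 0, 1, 0⟩ : ℍ[K, a, c]) * ⟨0, 0, 1, 0⟩ = algebraMap K _ c := by
    intro a c; ext <;> simp
  have qij : ∀ a c : K, (⟨0, 1, 0, 0⟩ : ℍ[K, a, c]) * ⟨0, 0, 1, 0⟩ =
      -(⟨0, 0, 1, 0⟩ * ⟨0, 1, 0, 0⟩) := by
    intro a c; ext <;> simp
  set i₁ : ℍ[K, r, u] ⊗[K] ℍ[K, s, t] := ⟨0, 1, 0, 0⟩ ⊗ₜ 1 with hi₁
  set j₁ : ℍ[K, r, u] ⊗[K] ℍ[K, s, t] := ⟨0, 0, 1, 0⟩ ⊗ₜ 1 with hj₁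
  set i₂ : ℍ[K, r, u] ⊗[K] ℍ[K, s, t] := 1 ⊗ₜ ⟨0, 1, 0, 0⟩ with hi₂
  set j₂ : ℍ[K, r, u] ⊗[K] ℍ[K, s, t] := 1 ⊗ₜ ⟨0, 0, 1, 0⟩ with hj₂
  have ri₁ : i₁ * i₁ = algebraMap K _ r := by
    rw [hi₁, Algebra.TensorProduct.tmul_mul_tmul, qi, mul_one]; rfl
  have rj₁ : j₁ * j₁ = algebraMap K _ u := by
    rw [hj₁, Algebra.TensorProduct.tmul_mul_tmul, qj, mul_one]; rfl
  have ri₂ : i₂ * i₂ = algebraMap K _ s := by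
    rw [hi₂, Algebra.TensorProduct.tmul_mul_tmul, qi, mul_one,
      Algebra.TensorProduct.algebraMap_apply']
  have rj₂ : j₂ * j₂ = algebraMap K _ t := by
    rw [hj₂, Algebra.TensorProduct.tmul_mul_tmul, qj, mul_one,
      Algebra.TensorProduct.algebraMap_apply']
  have rij₁ : i₁ * j₁ = -(j₁ * i₁) := by
    rw [hi₁, hj₁, Algebra.TensorProduct.tmul_mul_tmul, Algebra.TensorProduct.tmul_mul_tmul, qij,
      TensorProduct.neg_tmul]
  have rij₂ : i₂ * j₂ = -(j₂ * i₂) := by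
    rw [hi₂, hj₂, Algebra.TensorProduct.tmul_mul_tmul, Algebra.TensorProduct.tmul_mul_tmul, qij,
      TensorProduct.tmul_neg]
  have comm : ∀ (x : ℍ[K, r, u]) (y : ℍ[K, s, t]),
      (x ⊗ₜ[K] (1 : ℍ[K, s, t])) * ((1 : ℍ[K, r, u]) ⊗ₜ[K] y) =
        ((1 : ℍ[K, r, u]) ⊗ₜ[K] y) * (x ⊗ₜ[K] (1 : ℍ[K, s, t])) := by
    intro x y
    rw [Algebra.TensorProduct.tmul_mul_tmul, Algebra.TensorProduct.tmul_mul_tmul, one_mul,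
      one_mul, mul_one, mul_one]
  exact ⟨even_ord_of_isResidue_zero hfin w hϖ B hB h2 hres hr hs hu ht hβ hγ hσ hσβ hσγ
      ri₁ ri₂ rj₁ rj₂ rij₁ rij₂ (comm _ _) (comm _ _) (comm _ _) (comm _ _).symm,
    even_ord_of_isResidue_zero hfin w hϖ B hB h2 hres hs hr ht hu hγ hβ hτ hτγ hτβ
      ri₂ ri₁ rj₂ rj₁ rij₂ rij₁ (comm _ _).symm (comm _ _).symm (comm _ _).symm (comm _ _)⟩

end Residue

/-! ### Non-squares detected by root multiplicities -/

section OddMultiplicity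

variable {F : Type*} [Field F]

lemma mul_sq_ne_mul_sq_of_odd {a : F} {D₁ D₂ g h : F[X]} (hD₂ : D₂ ≠ 0)
    (hodd : Odd (D₁.rootMultiplicity a + D₂.rootMultiplicity a)) (hh : h ≠ 0) :
    D₁ * g ^ 2 ≠ D₂ * h ^ 2 := by
  intro heq
  have h2 : D₂ * h ^ 2 ≠ 0 := mul_ne_zero hD₂ (pow_ne_zero _ hh)
  have h1 := congrArg (Polynomial.rootMultiplicity a) heq
  rw [Polynomial.rootMultiplicity_mul h2, Polynomial.rootMultiplicity_mul (by rw [heq]; exact h2),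
    sq, sq, Polynomial.rootMultiplicity_mul (by
      intro h0; rw [sq, h0, mul_zero] at heq; exact h2 heq.symm),
    Polynomial.rootMultiplicity_mul (mul_ne_zero hh hh)] at h1
  obtain ⟨m, hm⟩ := hodd
  omega

end OddMultiplicity

/-! ### Gauss valuations and reduction of polynomials -/

section Gauss

variable {k K : Type*} [Field k] [Field K] [Algebra k K] {v : Valuation k ℤᵐ⁰}
  {w : Valuation K ℤᵐ⁰}

lemma gauss_lt_one_iff (p : k[X]) : gauss v p < 1 ↔ ∀ i, v (p.coeff i) < 1 := by
  rw [gauss, Finset.sup_lt_iff (by exact zero_lt_one)]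
  refine ⟨fun h i => ?_, fun h i _ => h i⟩
  by_cases hi : i ∈ p.support
  · exact h i hi
  · rw [Polynomial.notMem_support_iff.mp hi, map_zero]; exact zero_lt_one

lemma gauss_C (a : k) : gauss v (Polynomial.C a) = v a := by
  by_cases ha : a = 0
  · simp [gauss, ha]
  · simp [gauss, Polynomial.support_C ha]

lemma gauss_X : gauss v Polynomial.X = 1 := by
  simp [gauss, Polynomial.support_X (R := k)]

/-- Scaling by the inverse of a coefficient of largest value among all three polynomials makes them
integral with one reduction nonzero. The scalar is common, so that the fraction `(p + q y) / h` is
unchanged. -/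
lemma exists_normalization {p q h : k[X]} (hh : h ≠ 0) :
    ∃ (c : k) (P Q H : v.valuationSubring[X]), c ≠ 0 ∧
      P.map (algebraMap _ k) = Polynomial.C c * p ∧ Q.map (algebraMap _ k) = Polynomial.C c * q ∧
      H.map (algebraMap _ k) = Polynomial.C c * h ∧
      (P.map (IsLocalRing.residue v.valuationSubring) ≠ 0 ∨
        Q.map (IsLocalRing.residue v.valuationSubring) ≠ 0 ∨
        H.map (IsLocalRing.residue v.valuationSubring) ≠ 0) := by
  classical
  obtain ⟨e, he, hmax⟩ := (p.coeffs ∪ q.coeffs ∪ h.coeffs).exists_max_image v (by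
    refine ⟨h.leadingCoeff, Finset.mem_union_right _ ?_⟩
    exact Polynomial.coeff_mem_coeffs (by simpa using hh))
  have hcoeff : ∀ f : k[X], f.coeffs ⊆ p.coeffs ∪ q.coeffs ∪ h.coeffs → ∀ i,
      v (f.coeff i) ≤ v e := by
    intro f hf i
    by_cases hi : f.coeff i = 0
    · rw [hi, map_zero]; exact zero_le
    · exact hmax _ (hf (Polynomial.coeff_mem_coeffs hi))
  have he0 : e ≠ 0 := by
    intro h0
    have := hcoeff h Finset.subset_union_right h.natDegree
    rw [h0, map_zero, le_zero_iff, map_eq_zero] at this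
    exact hh (Polynomial.leadingCoeff_eq_zero.mp this)
  have hlift : ∀ f : k[X], f.coeffs ⊆ p.coeffs ∪ q.coeffs ∪ h.coeffs →
      ∃ P : v.valuationSubring[X], P.map (algebraMap _ k) = Polynomial.C e⁻¹ * f := by
    intro f hf
    rw [← Polynomial.mem_lifts, Polynomial.lifts_iff_coeff_lifts]
    intro i
    refine ⟨⟨(Polynomial.C e⁻¹ * f).coeff i, ?_⟩, rfl⟩
    rw [Valuation.mem_valuationSubring_iff, Polynomial.coeff_C_mul, map_mul, map_inv₀,
      inv_mul_le_iff₀ (zero_lt_iff.mpr ((map_ne_zero v).mpr he0)), mul_one]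
    exact hcoeff f hf i
  obtain ⟨P, hP⟩ := hlift p (Finset.subset_union_left.trans Finset.subset_union_left)
  obtain ⟨Q, hQ⟩ := hlift q (Finset.subset_union_right.trans Finset.subset_union_left)
  obtain ⟨H, hH⟩ := hlift h Finset.subset_union_right
  have hne : ∀ (f : k[X]) (P : v.valuationSubring[X]),
      P.map (algebraMap _ k) = Polynomial.C e⁻¹ * f → e ∈ f.coeffs →
      P.map (IsLocalRing.residue v.valuationSubring) ≠ 0 := by
    intro f P hP he h0
    obtain ⟨i, -, hi⟩ := Polynomial.mem_coeffs_iff.mp he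
    have h1 := congrArg (fun g => g.coeff i) hP
    simp only [Polynomial.coeff_map, Polynomial.coeff_C_mul, ← hi, inv_mul_cancel₀ he0] at h1
    have h2 : P.coeff i = 1 := Subtype.ext h1
    have h3 := congrArg (fun g => g.coeff i) h0
    simp only [Polynomial.coeff_map, h2, map_one, Polynomial.coeff_zero] at h3
    exact one_ne_zero h3
  refine ⟨e⁻¹, P, Q, H, inv_ne_zero he0, hP, hQ, hH, ?_⟩
  simp only [Finset.mem_union] at he
  rcases he with (he | he) | he
  · exact Or.inl (hne p P hP he)
  · exact Or.inr (Or.inl (hne q Q hQ he))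
  · exact Or.inr (Or.inr (hne h H hH he))

/-- The map of valuation rings induced by an extension of valued fields. -/
def integersMap (hvw : ∀ a : k, w (algebraMap k K a) = v a) :
    v.valuationSubring →+* w.valuationSubring :=
  ((algebraMap k K).comp v.valuationSubring.subtype).codRestrict w.valuationSubring.toSubring
    fun a => by
      change w (algebraMap k K a) ≤ 1
      rw [hvw]; exact a.2

lemma mem_maximalIdeal_iff (x : w.valuationSubring) :
    x ∈ IsLocalRing.maximalIdeal w.valuationSubring ↔ w x < 1 := by
  rw [ValuationSubring.valuation_lt_one_iff]
  exact (Valuation.isEquiv_valuation_valuationSubring w).lt_one_iff_lt_one.symm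

instance isLocalHom_integersMap (hvw : ∀ a : k, w (algebraMap k K a) = v a) :
    IsLocalHom (integersMap hvw) := by
  constructor
  intro a ha
  by_contra h
  have h1 : v a < 1 := (mem_maximalIdeal_iff (w := v) a).mp ((IsLocalRing.mem_maximalIdeal a).mpr h)
  rw [← hvw] at h1
  exact (IsLocalRing.mem_maximalIdeal _).mp ((mem_maximalIdeal_iff (integersMap hvw a)).mpr h1) ha

/-- The map of residue fields induced by an extension of valued fields. -/
def residueMap (hvw : ∀ a : k, w (algebraMap k K a) = v a) :
    IsLocalRing.ResidueField v.valuationSubring →+* IsLocalRing.ResidueField w.valuationSubring :=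
  IsLocalRing.ResidueField.map (integersMap hvw)

lemma valuation_aeval_lt_one_iff (hvw : ∀ a : k, w (algebraMap k K a) = v a) (x : w.valuationSubring)
    (P : v.valuationSubring[X]) :
    w (Polynomial.aeval (x : K) P) < 1 ↔
      (P.map (IsLocalRing.residue _)).eval₂ (residueMap hvw) (IsLocalRing.residue _ x) = 0 := by
  have h1 : ((P.eval₂ (integersMap hvw) x : w.valuationSubring) : K) =
      Polynomial.aeval (x : K) P := by
    have := Polynomial.hom_eval₂ P (integersMap hvw) w.valuationSubring.subtype x
    exact this
  have h2 : (P.map (IsLocalRing.residue _)).eval₂ (residueMap hvw) (IsLocalRing.residue _ x) =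
      IsLocalRing.residue _ (P.eval₂ (integersMap hvw) x) := by
    rw [Polynomial.eval₂_map, Polynomial.hom_eval₂]
    rfl
  rw [h2, IsLocalRing.residue_eq_zero_iff, mem_maximalIdeal_iff, h1]

lemma valuation_aeval_le_one {x : K} (hvw : ∀ a : k, w (algebraMap k K a) = v a) (hx : w x ≤ 1)
    (P : v.valuationSubring[X]) : w (Polynomial.aeval x P) ≤ 1 := by
  have h1 : ((P.eval₂ (integersMap hvw) ⟨x, hx⟩ : w.valuationSubring) : K) =
      Polynomial.aeval x P :=
    Polynomial.hom_eval₂ P (integersMap hvw) w.valuationSubring.subtype ⟨x, hx⟩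
  rw [← h1]
  exact (P.eval₂ (integersMap hvw) ⟨x, hx⟩).2

end Gauss

/-! ### The residue field of `w` and its squares -/

section Cubic

open Polynomial (X C aeval)

variable {k K : Type*} [Field k] [Field K] [Algebra k K] {v : Valuation k ℤᵐ⁰}
  {w : Valuation K ℤᵐ⁰} {x y : K} {a b c : v.valuationSubring}

/-- If `x` had a pole, each of the three factors would have the value of `x`, and their product
could not be the unit `y ^ 2`. -/
lemma valuation_le_one_of_cubic (hvw : ∀ a : k, w (algebraMap k K a) = v a) (hy : w y = 1)
    (hxy : y ^ 2 = aeval x ((X - C a) * (X - C b) * (X - C c))) : w x ≤ 1 := by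
  by_contra hx
  rw [not_le] at hx
  have h1 : ∀ e : v.valuationSubring, w (x - algebraMap k K e) = w x := by
    intro e
    refine Valuation.map_sub_eq_of_lt_left _ (lt_of_le_of_lt ?_ hx)
    rw [hvw]; exact e.2
  have h2 := congrArg w hxy
  simp only [map_mul, map_sub, Polynomial.aeval_X, Polynomial.aeval_C, map_pow, hy, one_pow] at h2
  change 1 = w (x - algebraMap k K a) * w (x - algebraMap k K b) * w (x - algebraMap k K c) at h2
  rw [h1, h1, h1] at h2
  exact absurd h2 (ne_of_lt (one_lt_mul'' (one_lt_mul'' hx hx) hx))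

/-- The residue of `x` is transcendental over the residue field of `v`. -/
lemma valuation_aeval_x_eq_one (hgauss : ∀ p : k[X], w (aeval y p) = gauss v p)
    (hxy : y ^ 2 = aeval x ((X - C a) * (X - C b) * (X - C c))) {P : v.valuationSubring[X]}
    (hP : P.map (IsLocalRing.residue _) ≠ 0) : w (aeval x P) = 1 := by
  have hvw : ∀ a : k, w (algebraMap k K a) = v a := fun a => by
    rw [← Polynomial.aeval_C y a, hgauss, gauss_C]
  have hy1 : w y = 1 := by rw [← Polynomial.aeval_X (R := k) y, hgauss, gauss_X]
  have hx1 := valuation_le_one_of_cubic hvw hy1 hxy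
  refine le_antisymm (valuation_aeval_le_one hvw hx1 P) (not_lt.mp fun hlt => ?_)
  let x₀ : w.valuationSubring := ⟨x, hx1⟩
  let y₀ : w.valuationSubring := ⟨y, hy1.le⟩
  rw [valuation_aeval_lt_one_iff hvw x₀] at hlt
  algebraize [residueMap hvw]
  have hxalg : IsAlgebraic (IsLocalRing.ResidueField v.valuationSubring)
      (IsLocalRing.residue _ x₀) := ⟨_, hP, hlt⟩
  have hxint := hxalg.isIntegral
  have hyeq : IsLocalRing.residue _ y₀ ^ 2 =
      (IsLocalRing.residue _ x₀ - IsLocalRing.residue _ (integersMap hvw a)) *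
      (IsLocalRing.residue _ x₀ - IsLocalRing.residue _ (integersMap hvw b)) *
      (IsLocalRing.residue _ x₀ - IsLocalRing.residue _ (integersMap hvw c)) := by
    rw [← map_sub, ← map_sub, ← map_sub, ← map_mul, ← map_mul, ← map_pow]
    congr 1
    apply Subtype.ext
    simp only [map_mul, map_sub, Polynomial.aeval_X, Polynomial.aeval_C] at hxy
    exact hxy
  have hint : ∀ e, IsIntegral (IsLocalRing.ResidueField v.valuationSubring)
      (IsLocalRing.residue _ x₀ - IsLocalRing.residue _ (integersMap hvw e)) := fun e =>
    hxint.sub (isIntegral_algebraMap (x := IsLocalRing.residue _ e))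
  -- Were the residue of `x` algebraic, the curve equation would make that of `y` algebraic, against
  -- the Gauss property of `w`.
  have hyint : IsIntegral (IsLocalRing.ResidueField v.valuationSubring)
      (IsLocalRing.residue _ y₀) :=
    IsIntegral.of_pow two_pos (hyeq ▸ ((hint a).mul (hint b)).mul (hint c))
  obtain ⟨q, hq0, hq⟩ := hyint.isAlgebraic
  obtain ⟨Q, rfl⟩ := Polynomial.map_surjective _ IsLocalRing.residue_surjective q
  have h1 : w (aeval y Q) < 1 := (valuation_aeval_lt_one_iff hvw y₀ Q).mpr hq
  rw [← Polynomial.aeval_map_algebraMap k, hgauss, gauss_lt_one_iff] at h1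
  refine hq0 (Polynomial.ext fun i => ?_)
  rw [Polynomial.coeff_map, Polynomial.coeff_zero, IsLocalRing.residue_eq_zero_iff,
    mem_maximalIdeal_iff]
  have := h1 i
  rwa [Polynomial.coeff_map] at this

lemma rootMultiplicity_X_sub_C_of_ne {F : Type*} [Field F] {d e : F} (h : d ≠ e) :
    (X - C e).rootMultiplicity d = 0 :=
  Polynomial.rootMultiplicity_eq_zero (by simpa [sub_eq_zero] using h)

lemma map_cubic_residue : ((X - C a) * (X - C b) * (X - C c)).map (IsLocalRing.residue _) =
    (X - C (IsLocalRing.residue _ a)) * (X - C (IsLocalRing.residue _ b)) *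
      (X - C (IsLocalRing.residue _ c)) := by
  simp

/-- Multiplying by the conjugate gives `P² - f Q²`, a polynomial in `x` of value less than one, so
its reduction vanishes because the residue of `x` is transcendental. The reduced `f` has a simple
root at the residue of `a`, so `P² = f Q²` forces both reductions to be zero. -/
lemma valuation_add_mul_y_lt_one (hgauss : ∀ p : k[X], w (aeval y p) = gauss v p)
    (hxy : y ^ 2 = aeval x ((X - C a) * (X - C b) * (X - C c)))
    (hab : IsLocalRing.residue _ a ≠ IsLocalRing.residue _ b)
    (hac : IsLocalRing.residue _ a ≠ IsLocalRing.residue _ c)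
    {P Q : v.valuationSubring[X]} (h : w (aeval x P + aeval x Q * y) < 1) :
    P.map (IsLocalRing.residue _) = 0 ∧ Q.map (IsLocalRing.residue _) = 0 := by
  have hvw : ∀ a : k, w (algebraMap k K a) = v a := fun a => by
    rw [← Polynomial.aeval_C y a, hgauss, gauss_C]
  have hy1 : w y = 1 := by rw [← Polynomial.aeval_X (R := k) y, hgauss, gauss_X]
  have hx1 := valuation_le_one_of_cubic hvw hy1 hxy
  set f := (X - C a) * (X - C b) * (X - C c) with hf
  have hnorm : w (aeval x (P ^ 2 - f * Q ^ 2)) < 1 := by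
    have : aeval x (P ^ 2 - f * Q ^ 2) =
        (aeval x P + aeval x Q * y) * (aeval x P - aeval x Q * y) := by
      rw [map_sub, map_mul, map_pow, map_pow, ← hxy]; ring
    rw [this, map_mul]
    refine mul_lt_one_of_lt_of_le h (Valuation.map_sub_le _ (valuation_aeval_le_one hvw hx1 P) ?_)
    rw [map_mul, hy1, mul_one]
    exact valuation_aeval_le_one hvw hx1 Q
  have h0 : (P ^ 2 - f * Q ^ 2).map (IsLocalRing.residue _) = 0 := by
    by_contra hne
    exact absurd (valuation_aeval_x_eq_one hgauss hxy hne) hnorm.ne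
  rw [Polynomial.map_sub, Polynomial.map_mul, Polynomial.map_pow, Polynomial.map_pow, sub_eq_zero,
    hf, map_cubic_residue] at h0
  have hf0 : (X - C (IsLocalRing.residue _ a)) * (X - C (IsLocalRing.residue _ b)) *
      (X - C (IsLocalRing.residue _ c)) ≠ 0 :=
    mul_ne_zero (mul_ne_zero (Polynomial.X_sub_C_ne_zero _) (Polynomial.X_sub_C_ne_zero _))
      (Polynomial.X_sub_C_ne_zero _)
  have hQ : Q.map (IsLocalRing.residue _) = 0 := by
    by_contra hQ
    refine mul_sq_ne_mul_sq_of_odd (a := IsLocalRing.residue _ a) (D₁ := 1)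
      (g := P.map (IsLocalRing.residue _)) hf0 ?_ hQ (by rw [one_mul, h0])
    rw [Polynomial.rootMultiplicity_mul hf0, Polynomial.rootMultiplicity_mul
      (left_ne_zero_of_mul hf0), Polynomial.rootMultiplicity_X_sub_C_self,
      rootMultiplicity_X_sub_C_of_ne hab, rootMultiplicity_X_sub_C_of_ne hac,
      Polynomial.rootMultiplicity_eq_zero (by simp)]
    exact odd_one
  refine ⟨?_, hQ⟩
  rw [hQ, sq (0 : Polynomial _), mul_zero, mul_zero] at h0
  exact pow_eq_zero_iff two_ne_zero |>.mp h0

/-- A polynomial in `x` whose reduction `D` is such that neither `D` nor `f D` is a square is not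
a square in the residue field of `w`. -/
theorem one_le_valuation_sq_sub (hgauss : ∀ p : k[X], w (aeval y p) = gauss v p)
    (hxy : y ^ 2 = aeval x ((X - C a) * (X - C b) * (X - C c))) (h2 : v 2 = 1)
    (hab : IsLocalRing.residue _ a ≠ IsLocalRing.residue _ b)
    (hac : IsLocalRing.residue _ a ≠ IsLocalRing.residue _ c)
    (hrep : ∀ z : K, ∃ p q h : k[X], aeval x h ≠ 0 ∧ z = (aeval x p + aeval x q * y) / aeval x h)
    {D : v.valuationSubring[X]} {d e : IsLocalRing.ResidueField v.valuationSubring}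
    (hD0 : D.map (IsLocalRing.residue _) ≠ 0)
    (hd : Odd ((D.map (IsLocalRing.residue _)).rootMultiplicity d))
    (he : Odd (((X - C (IsLocalRing.residue _ a)) * (X - C (IsLocalRing.residue _ b)) *
      (X - C (IsLocalRing.residue _ c))).rootMultiplicity e +
      (D.map (IsLocalRing.residue _)).rootMultiplicity e)) (z : K) :
    1 ≤ w (z ^ 2 - aeval x D) := by
  by_contra hlt
  rw [not_le] at hlt
  have hvw : ∀ a : k, w (algebraMap k K a) = v a := fun a => by
    rw [← Polynomial.aeval_C y a, hgauss, gauss_C]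
  have hy1 : w y = 1 := by rw [← Polynomial.aeval_X (R := k) y, hgauss, gauss_X]
  have hx1 := valuation_le_one_of_cubic hvw hy1 hxy
  obtain ⟨p, q, h, hh, rfl⟩ := hrep z
  obtain ⟨e₀, P, Q, H, he₀, hP, hQ, hH, hne⟩ := exists_normalization (v := v) (p := p) (q := q)
    (h := h) (by rintro rfl; exact hh (map_zero _))
  have hev : ∀ {p : k[X]} {P : v.valuationSubring[X]}, P.map (algebraMap _ k) = C e₀ * p →
      aeval x P = algebraMap k K e₀ * aeval x p := by
    intro p P h
    rw [← Polynomial.aeval_map_algebraMap k, h, map_mul, Polynomial.aeval_C]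
  have he₀' : algebraMap k K e₀ ≠ 0 := by simpa using he₀
  have hHx : aeval x H ≠ 0 := by rw [hev hH]; exact mul_ne_zero he₀' hh
  have hz : (aeval x p + aeval x q * y) / aeval x h =
      (aeval x P + aeval x Q * y) / aeval x H := by
    rw [hev hP, hev hQ, hev hH]; field_simp
  rw [hz] at hlt
  set z := (aeval x P + aeval x Q * y) / aeval x H with hzdef
  have hz1 : w z ≤ 1 := by
    by_contra hz
    rw [not_le] at hz
    have h1 : 1 < w (z ^ 2) := by rw [map_pow]; exact one_lt_pow₀ hz two_ne_zero
    rw [Valuation.map_sub_eq_of_lt_left _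
      (lt_of_le_of_lt (valuation_aeval_le_one hvw hx1 D) h1)] at hlt
    exact absurd h1 (not_lt.mpr hlt.le)
  have hzH : z * aeval x H = aeval x P + aeval x Q * y := div_mul_cancel₀ _ hHx
  -- If `H` reduced to zero, integrality of `z` would make `P + Q y` reduce to zero, hence `P` and
  -- `Q` as well, against the normalization.
  have hH0 : H.map (IsLocalRing.residue _) ≠ 0 := by
    intro hH0
    have h1 : w (aeval x H) < 1 := by
      rw [valuation_aeval_lt_one_iff hvw ⟨x, hx1⟩, hH0, Polynomial.eval₂_zero]
    have h3 : w (aeval x P + aeval x Q * y) < 1 := by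
      rw [← hzH, map_mul]
      rw [mul_comm]
      exact mul_lt_one_of_lt_of_le h1 hz1
    obtain ⟨h4, h5⟩ := valuation_add_mul_y_lt_one hgauss hxy hab hac h3
    simp [h4, h5, hH0] at hne
  set f := (X - C a) * (X - C b) * (X - C c) with hf
  clear_value f
  -- Clear denominators in `z² - D` and separate the components along `1` and `y` using `y² = f`.
  have hmain : w (aeval x (P ^ 2 + f * Q ^ 2 - D * H ^ 2) + aeval x (2 * P * Q) * y) < 1 := by
    have : aeval x (P ^ 2 + f * Q ^ 2 - D * H ^ 2) + aeval x (2 * P * Q) * y =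
        (z ^ 2 - aeval x D) * aeval x H ^ 2 := by
      have h6 : (z ^ 2 - aeval x D) * aeval x H ^ 2 =
          (z * aeval x H) ^ 2 - aeval x D * aeval x H ^ 2 := by ring
      rw [h6, hzH]
      simp only [map_add, map_sub, map_mul, map_pow, map_ofNat]
      rw [← hxy]; ring
    rw [this, map_mul, map_pow]
    exact mul_lt_one_of_lt_of_le hlt (pow_le_one' (valuation_aeval_le_one hvw hx1 H) _)
  obtain ⟨h3, h4⟩ := valuation_add_mul_y_lt_one hgauss (hf ▸ hxy) hab hac hmain
  have h20 : (2 : (IsLocalRing.ResidueField v.valuationSubring)[X]) ≠ 0 := by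
    have h5 : IsLocalRing.residue v.valuationSubring 2 ≠ 0 := by
      rw [Ne, IsLocalRing.residue_eq_zero_iff, mem_maximalIdeal_iff]
      exact not_lt.mpr h2.ge
    rw [map_ofNat] at h5
    rw [← map_ofNat (C : _ →+* (IsLocalRing.ResidueField v.valuationSubring)[X]) 2]
    exact Polynomial.C_ne_zero.mpr h5
  simp only [Polynomial.map_mul, Polynomial.map_ofNat, mul_eq_zero, h20, false_or] at h4
  rw [Polynomial.map_sub, Polynomial.map_add, Polynomial.map_mul, Polynomial.map_mul,
    Polynomial.map_pow, Polynomial.map_pow, Polynomial.map_pow, sub_eq_zero, hf,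
    map_cubic_residue] at h3
  -- The `y`-component gives `P = 0` or `Q = 0` after reduction. The other component is then `f Q² =
  -- D H²`, excluded at `e`, or `P² = D H²`, excluded at `d`.
  rcases h4 with h4 | h4
  · rw [h4, sq (0 : Polynomial _), mul_zero, zero_add] at h3
    exact mul_sq_ne_mul_sq_of_odd hD0 he hH0 h3
  · rw [h4, sq (0 : Polynomial _), mul_zero, mul_zero, add_zero, ← one_mul (_ ^ 2)] at h3
    refine mul_sq_ne_mul_sq_of_odd (a := d) hD0 ?_ hH0 h3
    rwa [Polynomial.rootMultiplicity_eq_zero (p := 1) (by simp), zero_add]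

end Cubic

/-! ### The function field as a quadratic extension of `k(x)` -/

section FunctionField

open Polynomial (X C aeval)
open WeierstrassCurve.Affine

variable {k : Type*} [Field k] {α β γ : k}

lemma mk_C_eq_aeval (p : k[X]) : CoordinateRing.mk (curve α β γ) (C p) =
    aeval (CoordinateRing.mk (curve α β γ) (C X)) p := by
  induction p using Polynomial.induction_on' with
  | add p q hp hq => rw [map_add, map_add, map_add, hp, hq]
  | monomial n a =>
    rw [← Polynomial.C_mul_X_pow_eq_monomial, map_mul, map_mul, map_pow, map_pow, map_mul, map_pow,
      Polynomial.aeval_X, Polynomial.aeval_C]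
    rfl

lemma aeval_xFun (p : k[X]) : aeval (xFun α β γ) p =
    algebraMap (curve α β γ).CoordinateRing (FunField α β γ)
      (CoordinateRing.mk (curve α β γ) (C p)) := by
  rw [mk_C_eq_aeval, xFun, Polynomial.aeval_algebraMap_apply]

lemma yFun_sq : yFun α β γ ^ 2 = aeval (xFun α β γ) (cubic α β γ) := by
  rw [aeval_xFun, yFun, ← map_pow, ← map_pow]
  congr 1
  rw [AdjoinRoot.mk_eq_mk]
  refine dvd_of_eq ?_
  simp [WeierstrassCurve.Affine.polynomial, curve, cubic]

/-- The coordinate ring is finite over `k[x]`, so every nonzero denominator divides a nonzero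
polynomial in `x`; `1` and `y` form a basis for the numerators. -/
lemma exists_eq_div (z : FunField α β γ) : ∃ p q h : k[X], aeval (xFun α β γ) h ≠ 0 ∧
    z = (aeval (xFun α β γ) p + aeval (xFun α β γ) q * yFun α β γ) / aeval (xFun α β γ) h := by
  obtain ⟨n, d, hd, rfl⟩ := IsFractionRing.div_surjective (curve α β γ).CoordinateRing z
  have : Module.Finite k[X] (curve α β γ).CoordinateRing :=
    Module.Finite.of_basis (CoordinateRing.basis (curve α β γ))
  have hint : IsIntegral k[X] d := Algebra.IsIntegral.isIntegral d
  obtain ⟨m, h, hh, hm⟩ := hint.isAlgebraic.exists_smul_eq_mul n hd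
  obtain ⟨p, q, rfl⟩ := CoordinateRing.exists_smul_basis_eq m
  have hd0 : algebraMap (curve α β γ).CoordinateRing (FunField α β γ) d ≠ 0 := by
    simpa using nonZeroDivisors.ne_zero hd
  have hh0 : aeval (xFun α β γ) h ≠ 0 := by
    rw [aeval_xFun]
    intro h0
    rw [map_eq_zero_iff _ (IsFractionRing.injective _ _)] at h0
    have h1 := CoordinateRing.smul_basis_eq_zero (W' := curve α β γ) (p := h) (q := 0) (by
      rw [zero_smul, add_zero, CoordinateRing.smul, h0, zero_mul])
    exact hh h1.1
  refine ⟨p, q, h, hh0, ?_⟩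
  rw [div_eq_div_iff hd0 hh0]
  have h2 := congrArg (algebraMap (curve α β γ).CoordinateRing (FunField α β γ)) hm
  rw [CoordinateRing.smul, CoordinateRing.smul, CoordinateRing.smul] at h2
  simp only [map_mul, map_add, mul_one, ← aeval_xFun] at h2
  rw [mul_comm, h2, mul_comm]
  rfl

end FunctionField

/-! ### Integrality of the roots and the discriminant -/

section Roots

variable {k : Type*} [Field k] {v : Valuation k ℤᵐ⁰} {α β γ a b c : k}

lemma valuation_root_le_one (hα : v α ≤ 1) (hβ : v β ≤ 1) (hγ : v γ ≤ 1)
    (h : (cubic α β γ).eval a = 0) : v a ≤ 1 := by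
  refine (Valuation.valuationSubring.integers v).mem_of_integral
    ⟨Polynomial.X ^ 3 + Polynomial.C ⟨α, hα⟩ * Polynomial.X ^ 2 +
      Polynomial.C ⟨β, hβ⟩ * Polynomial.X + Polynomial.C ⟨γ, hγ⟩, ?_, ?_⟩
  · monicity!
  · simp only [cubic, Polynomial.eval_add, Polynomial.eval_mul, Polynomial.eval_pow,
      Polynomial.eval_X, Polynomial.eval_C] at h
    simp only [Polynomial.eval₂_add, Polynomial.eval₂_mul, Polynomial.eval₂_pow,
      Polynomial.eval₂_X, Polynomial.eval₂_C]
    exact h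

lemma cubic_discr (hf : cubic α β γ = (Polynomial.X - Polynomial.C a) *
    (Polynomial.X - Polynomial.C b) * (Polynomial.X - Polynomial.C c)) :
    (cubic α β γ).discr = ((a - b) * (a - c) * (b - c)) ^ 2 := by
  have hcub : (Polynomial.X - Polynomial.C a) * (Polynomial.X - Polynomial.C b) *
      (Polynomial.X - Polynomial.C c) =
      cubic (-(a + b + c)) (a * b + a * c + b * c) (-(a * b * c)) := by
    simp only [cubic, Polynomial.C_neg, Polynomial.C_add, Polynomial.C_mul]; ring
  have hco : ∀ α β γ : k, (cubic α β γ).coeff 0 = γ ∧ (cubic α β γ).coeff 1 = β ∧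
      (cubic α β γ).coeff 2 = α ∧ (cubic α β γ).coeff 3 = 1 := by
    intro α β γ
    simp [cubic, Polynomial.coeff_X, Polynomial.coeff_C, Polynomial.coeff_X_pow]
  have hdeg : (cubic α β γ).degree = 3 := by
    unfold cubic; compute_degree!
  rw [Polynomial.discr_of_degree_eq_three hdeg, hf, hcub]
  obtain ⟨h0, h1, h2, h3⟩ := hco (-(a + b + c)) (a * b + a * c + b * c) (-(a * b * c))
  rw [h0, h1, h2, h3]; ring

end Roots

/-! ### Independence of `x - b` and `x - c` modulo squares -/

section Nonsquare

open Polynomial (X C aeval)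

variable {k K : Type*} [Field k] [Field K] [Algebra k K] {v : Valuation k ℤᵐ⁰}
  {w : Valuation K ℤᵐ⁰} {x y : K} {a b c : v.valuationSubring}

/-- After reduction, `x - b` has a simple root at `b`, and `f (x - b)` has a simple root at `a`. -/
lemma one_le_valuation_sq_sub_linear (hgauss : ∀ p : k[X], w (aeval y p) = gauss v p)
    (hxy : y ^ 2 = aeval x ((X - C a) * (X - C b) * (X - C c))) (h2 : v 2 = 1)
    (hab : IsLocalRing.residue _ a ≠ IsLocalRing.residue _ b)
    (hac : IsLocalRing.residue _ a ≠ IsLocalRing.residue _ c)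
    (hrep : ∀ z : K, ∃ p q h : k[X], aeval x h ≠ 0 ∧ z = (aeval x p + aeval x q * y) / aeval x h)
    (z : K) : 1 ≤ w (z ^ 2 - aeval x (X - C b)) := by
  have h0 : ∀ e : IsLocalRing.ResidueField v.valuationSubring, X - C e ≠ 0 :=
    Polynomial.X_sub_C_ne_zero
  refine one_le_valuation_sq_sub hgauss hxy h2 hab hac hrep (d := IsLocalRing.residue _ b)
    (e := IsLocalRing.residue _ a) ?_ ?_ ?_ z <;>
  rw [Polynomial.map_sub, Polynomial.map_X, Polynomial.map_C]
  · exact h0 _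
  · rw [Polynomial.rootMultiplicity_X_sub_C_self]; exact odd_one
  · rw [Polynomial.rootMultiplicity_mul (mul_ne_zero (mul_ne_zero (h0 _) (h0 _)) (h0 _)),
      Polynomial.rootMultiplicity_mul (mul_ne_zero (h0 _) (h0 _)),
      Polynomial.rootMultiplicity_X_sub_C_self, rootMultiplicity_X_sub_C_of_ne hab,
      rootMultiplicity_X_sub_C_of_ne hac]
    exact odd_one

/-- The same two roots serve: `b` is simple in `(x - b)(x - c)` because `b` and `c` have distinct
residues, and `a` is simple in its product with `f`. -/
lemma one_le_valuation_sq_sub_quadratic (hgauss : ∀ p : k[X], w (aeval y p) = gauss v p)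
    (hxy : y ^ 2 = aeval x ((X - C a) * (X - C b) * (X - C c))) (h2 : v 2 = 1)
    (hab : IsLocalRing.residue _ a ≠ IsLocalRing.residue _ b)
    (hac : IsLocalRing.residue _ a ≠ IsLocalRing.residue _ c)
    (hbc : IsLocalRing.residue _ b ≠ IsLocalRing.residue _ c)
    (hrep : ∀ z : K, ∃ p q h : k[X], aeval x h ≠ 0 ∧ z = (aeval x p + aeval x q * y) / aeval x h)
    (z : K) : 1 ≤ w (z ^ 2 - aeval x ((X - C b) * (X - C c))) := by
  have h0 : ∀ e : IsLocalRing.ResidueField v.valuationSubring, X - C e ≠ 0 :=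
    Polynomial.X_sub_C_ne_zero
  refine one_le_valuation_sq_sub hgauss hxy h2 hab hac hrep (d := IsLocalRing.residue _ b)
    (e := IsLocalRing.residue _ a) ?_ ?_ ?_ z <;>
  rw [Polynomial.map_mul, Polynomial.map_sub, Polynomial.map_sub, Polynomial.map_X,
    Polynomial.map_C, Polynomial.map_C]
  · exact mul_ne_zero (h0 _) (h0 _)
  · rw [Polynomial.rootMultiplicity_mul (mul_ne_zero (h0 _) (h0 _)),
      Polynomial.rootMultiplicity_X_sub_C_self, rootMultiplicity_X_sub_C_of_ne hbc]
    exact odd_one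
  · rw [Polynomial.rootMultiplicity_mul (mul_ne_zero (mul_ne_zero (h0 _) (h0 _)) (h0 _)),
      Polynomial.rootMultiplicity_mul (mul_ne_zero (h0 _) (h0 _)),
      Polynomial.rootMultiplicity_mul (mul_ne_zero (h0 _) (h0 _)),
      Polynomial.rootMultiplicity_X_sub_C_self, rootMultiplicity_X_sub_C_of_ne hab,
      rootMultiplicity_X_sub_C_of_ne hac]
    exact odd_one

end Nonsquare

/-- The statement at a single discrete valuation of good reduction. -/
theorem even_ord_of_isUnramified_curve {k : Type*} [Field k] {α β γ a b c : k}
    (hf : cubic α β γ = (Polynomial.X - Polynomial.C a) * (Polynomial.X - Polynomial.C b) *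
      (Polynomial.X - Polynomial.C c)) {v : Valuation k ℤᵐ⁰} (hsurj : Function.Surjective v)
    (h2 : v 2 = 1) (hdisc : v (cubic α β γ).discr = 1) (hα : v α ≤ 1) (hβ : v β ≤ 1) (hγ : v γ ≤ 1)
    {w : Valuation (FunField α β γ) ℤᵐ⁰} (hw : ExtendsGauss v w) {r s : k} (hr : r ≠ 0)
    (hs : s ≠ 0)
    (hΔ : IsUnramified w
      (ℍ[FunField α β γ, algebraMap k (FunField α β γ) r,
          xFun α β γ - algebraMap k (FunField α β γ) b] ⊗[FunField α β γ]
        ℍ[FunField α β γ, algebraMap k (FunField α β γ) s,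
          xFun α β γ - algebraMap k (FunField α β γ) c])) :
    Even (ord v r) ∧ Even (ord v s) := by
  have hvw : ∀ a : k, w (algebraMap k _ a) = v a := fun a => by
    rw [← Polynomial.aeval_C (yFun α β γ) a, hw, gauss_C]
  have ha1 : v a ≤ 1 := valuation_root_le_one hα hβ hγ (by rw [hf]; simp)
  have hb1 : v b ≤ 1 := valuation_root_le_one hα hβ hγ (by rw [hf]; simp)
  have hc1 : v c ≤ 1 := valuation_root_le_one hα hβ hγ (by rw [hf]; simp)
  set a₀ : v.valuationSubring := ⟨a, ha1⟩
  set b₀ : v.valuationSubring := ⟨b, hb1⟩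
  set c₀ : v.valuationSubring := ⟨c, hc1⟩
  rw [cubic_discr hf, map_pow, map_mul, map_mul] at hdisc
  have hne : ∀ d e : v.valuationSubring, IsLocalRing.residue _ d = IsLocalRing.residue _ e →
      v ((d : k) - e) < 1 := by
    intro d e h
    rw [← sub_eq_zero, ← map_sub, IsLocalRing.residue_eq_zero_iff, mem_maximalIdeal_iff] at h
    exact h
  have hle : ∀ d e : v.valuationSubring, v ((d : k) - e) ≤ 1 := fun d e =>
    Valuation.map_sub_le _ d.2 e.2
  -- All three root differences have value at most one; a product of value one makes them units, so
  -- the roots stay distinct modulo `v`.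
  have hprod : v (a - b) * v (a - c) * v (b - c) = 1 :=
    (pow_left_inj₀ zero_le zero_le two_ne_zero).mp (by rw [hdisc, one_pow])
  have hab : IsLocalRing.residue _ a₀ ≠ IsLocalRing.residue _ b₀ := fun h =>
    (mul_lt_one_of_lt_of_le (mul_lt_one_of_lt_of_le (hne _ _ h) (hle a₀ c₀)) (hle b₀ c₀)).ne hprod
  have hac : IsLocalRing.residue _ a₀ ≠ IsLocalRing.residue _ c₀ := fun h => by
    rw [mul_comm (v (a - b))] at hprod
    exact (mul_lt_one_of_lt_of_le (mul_lt_one_of_lt_of_le (hne _ _ h) (hle a₀ b₀))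
      (hle b₀ c₀)).ne hprod
  have hbc : IsLocalRing.residue _ b₀ ≠ IsLocalRing.residue _ c₀ := fun h => by
    rw [mul_comm] at hprod
    exact (mul_lt_one_of_lt_of_le (hne _ _ h) (mul_le_one' (hle a₀ b₀) (hle a₀ c₀))).ne hprod
  have hlin : ∀ e : v.valuationSubring,
      Polynomial.aeval (xFun α β γ) (Polynomial.X - Polynomial.C e) =
        xFun α β γ - algebraMap k (FunField α β γ) e := by
    intro e
    rw [map_sub, Polynomial.aeval_X, Polynomial.aeval_C]
    rfl
  have hxy : yFun α β γ ^ 2 = Polynomial.aeval (xFun α β γ)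
      ((Polynomial.X - Polynomial.C a₀) * (Polynomial.X - Polynomial.C b₀) *
        (Polynomial.X - Polynomial.C c₀)) := by
    rw [yFun_sq, hf]
    simp only [map_mul, hlin, map_sub, Polynomial.aeval_X, Polynomial.aeval_C]
    rfl
  -- The equation with `b` and `c` exchanged, to obtain the non-square statement for `x - c` from
  -- the one for `x - b`.
  have hxy' : yFun α β γ ^ 2 = Polynomial.aeval (xFun α β γ)
      ((Polynomial.X - Polynomial.C a₀) * (Polynomial.X - Polynomial.C c₀) *
        (Polynomial.X - Polynomial.C b₀)) := by
    rw [hxy, mul_assoc, mul_comm (Polynomial.X - Polynomial.C b₀), ← mul_assoc]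
  have hunit : ∀ e : v.valuationSubring,
      w (xFun α β γ - algebraMap k (FunField α β γ) e) = 1 := by
    intro e
    rw [← hlin]
    refine valuation_aeval_x_eq_one hw hxy ?_
    rw [Polynomial.map_sub, Polynomial.map_X, Polynomial.map_C]
    exact Polynomial.X_sub_C_ne_zero _
  have hmain := even_ord_of_isUnramified w
    (fun z => by
      obtain ⟨q, hq⟩ := hsurj z
      exact ⟨algebraMap k _ q, by rw [hvw, hq]⟩)
    (by rw [← map_ofNat (algebraMap k (FunField α β γ)) 2, hvw, h2])
    (r := algebraMap k (FunField α β γ) r) (s := algebraMap k (FunField α β γ) s)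
    (by simpa using hr) (by simpa using hs) (hunit b₀) (hunit c₀)
    (fun z => by
      rw [← hlin]
      exact one_le_valuation_sq_sub_linear hw hxy h2 hab hac exists_eq_div z)
    (fun z => by
      rw [← hlin]
      exact one_le_valuation_sq_sub_linear hw hxy' h2 hac hab exists_eq_div z)
    (fun z => by
      rw [← hlin, ← hlin, ← map_mul]
      exact one_le_valuation_sq_sub_quadratic hw hxy h2 hab hac hbc exists_eq_div z) hΔ
  simpa only [ord, hvw] using hmain

end EllipticRamification

end

open EllipticRamification in
theorem proposition4p7 {k : Type*} [Field k] [NumberField k]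
    -- the elliptic curve `y² = f(x)`, split over `k`
    (α β γ a b c : k)
    (hf : cubic α β γ = (Polynomial.X - Polynomial.C a) * (Polynomial.X - Polynomial.C b) *
      (Polynomial.X - Polynomial.C c))
    (hδ : (cubic α β γ).discr ≠ 0)
    -- the finite set of places `S`
    (S : Finset (NumberField.InfinitePlace k ⊕
      IsDedekindDomain.HeightOneSpectrum (NumberField.RingOfIntegers k)))
    (hSinf : ∀ u : NumberField.InfinitePlace k, Sum.inl u ∈ S)
    (hStwo : ∀ u : IsDedekindDomain.HeightOneSpectrum (NumberField.RingOfIntegers k),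
      u.valuation k 2 ≠ 1 → Sum.inr u ∈ S)
    (hSdisc : ∀ u : IsDedekindDomain.HeightOneSpectrum (NumberField.RingOfIntegers k),
      u.valuation k (cubic α β γ).discr ≠ 1 → Sum.inr u ∈ S)
    (hScoeff : ∀ u : IsDedekindDomain.HeightOneSpectrum (NumberField.RingOfIntegers k),
      (1 < u.valuation k α ∨ 1 < u.valuation k β ∨ 1 < u.valuation k γ) → Sum.inr u ∈ S)
    -- a place `v` outside `S` and the corresponding valuation `w = w(v)`
    (v : IsDedekindDomain.HeightOneSpectrum (NumberField.RingOfIntegers k))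
    (hv : Sum.inr v ∉ S)
    (w : Valuation (FunField α β γ) ℤᵐ⁰)
    (hw : ExtendsGauss (v.valuation k) w)
    (r s : kˣ)
    (hΔ : IsUnramified w
      (ℍ[FunField α β γ, algebraMap k (FunField α β γ) r,
          xFun α β γ - algebraMap k (FunField α β γ) b] ⊗[FunField α β γ]
        ℍ[FunField α β γ, algebraMap k (FunField α β γ) s,
          xFun α β γ - algebraMap k (FunField α β γ) c])) :
    Even (ord (v.valuation k) (r : k)) ∧ Even (ord (v.valuation k) (s : k)) := by
  have hco : ¬ (1 < v.valuation k α ∨ 1 < v.valuation k β ∨ 1 < v.valuation k γ) :=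
    fun h => hv (hScoeff v h)
  push Not at hco
  exact even_ord_of_isUnramified_curve hf (v.valuation_surjective k)
    (not_not.mp fun h => hv (hStwo v h)) (not_not.mp fun h => hv (hSdisc v h)) hco.1 hco.2.1
    hco.2.2 hw r.ne_zero s.ne_zero hΔ
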